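/- Let $R$ be an associative unital ring. A right $R$-module is called countably presentable if it is an $\aleph_1$-presentable object of the category $\mathrm{Mod}\text{-}R$ of right $R$-modules, i.e. if the functor $\operatorname{Hom}_R(M,-)$ preserves $\aleph_1$-directed colimits. Assume that $R$ is right countably coherent, i.e. that every finitely generated right ideal of $R$ is countably presentable as a right $R$-module. Let $m\ge 0$ be an integer, and let $\mathsf F_m\subset\mathrm{Mod}\text{-}R$ be the full subcategory of all right $R$-modules of flat dimension at most $m$, i.e. of all modules $M$ that admit an exact sequence $0\to F_m\to\dots\to F_1\to F_0\to M\to 0$ with flat right $R$-modules $F_0,\dots,F_m$. Then: (1) the category $\mathsf F_m$ is $\aleph_1$-accessible; (2) an object of $\mathsf F_m$ is $\aleph_1$-presentable in $\mathsf F_m$ if and only if it is countably presentable as an object of $\mathrm{Mod}\text{-}R$; (3) every right $R$-module of flat dimension at most $m$ is the colimit, in $\mathrm{Mod}\text{-}R$, of a diagram of countably presentable right $R$-modules of flat dimension at most $m$, indexed by an $\aleph_1$-directed poset (a poset in which every countable subset has an upper bound). -/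

import Mathlib

open CategoryTheory
open scoped Cardinal TensorProduct MulOpposite

universe u

/-- `ℵ₁` is a regular cardinal, as an instance: the notions of presentable objects and of
accessible categories are relative to a regular cardinal. -/
instance fact_isRegular_aleph_one : Fact (Cardinal.IsRegular (ℵ₁ : Cardinal.{u})) :=
  ⟨Cardinal.isRegular_aleph_one⟩

section Tensor

variable (R : Type*) [Ring R]

/-- The subgroup of `M ⊗[ℤ] N` generated by the relations `(m r) ⊗ n = m ⊗ (r n)`, for a
right `R`-module `M` (a module over the opposite ring) and a left `R`-module `N`. -/
def balancedRelations (M N : Type*) [AddCommGroup M] [Module Rᵐᵒᵖ M]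
    [AddCommGroup N] [Module R N] : AddSubgroup (M ⊗[ℤ] N) :=
  AddSubgroup.closure
    {t | ∃ (m : M) (r : R) (n : N), t = (MulOpposite.op r • m) ⊗ₜ[ℤ] n - m ⊗ₜ[ℤ] (r • n)}

/-- The tensor product over `R` of a right `R`-module `M` and a left `R`-module `N`:
an abelian group. -/
abbrev BalancedTensor (M N : Type*) [AddCommGroup M] [Module Rᵐᵒᵖ M]
    [AddCommGroup N] [Module R N] : Type _ :=
  (M ⊗[ℤ] N) ⧸ balancedRelations R M N

variable {R}

theorem balancedRelations_le_comap (M : Type*) {N N' : Type*} [AddCommGroup M] [Module Rᵐᵒᵖ M]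
    [AddCommGroup N] [Module R N] [AddCommGroup N'] [Module R N'] (f : N →ₗ[R] N') :
    balancedRelations R M N ≤ (balancedRelations R M N').comap
      (LinearMap.lTensor M f.toAddMonoidHom.toIntLinearMap).toAddMonoidHom := by
  refine (AddSubgroup.closure_le _).2 ?_
  rintro _ ⟨m, r, n, rfl⟩
  refine AddSubgroup.subset_closure ⟨m, r, f n, ?_⟩
  simp

/-- The map `M ⊗_R f : M ⊗_R N → M ⊗_R N'` induced by a map `f` of left `R`-modules. -/
def BalancedTensor.map (M : Type*) {N N' : Type*} [AddCommGroup M] [Module Rᵐᵒᵖ M]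
    [AddCommGroup N] [Module R N] [AddCommGroup N'] [Module R N'] (f : N →ₗ[R] N') :
    BalancedTensor R M N →+ BalancedTensor R M N' :=
  QuotientAddGroup.map _ _ (LinearMap.lTensor M f.toAddMonoidHom.toIntLinearMap).toAddMonoidHom
    (balancedRelations_le_comap M f)

end Tensor

/-- A right `R`-module `M` is flat if `M ⊗_R -` preserves injective maps of left `R`-modules. -/
def IsFlatRight (R : Type u) [Ring R] (M : Type u) [AddCommGroup M] [Module Rᵐᵒᵖ M] : Prop :=
  ∀ (N N' : Type u) [AddCommGroup N] [Module R N] [AddCommGroup N'] [Module R N']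
    (f : N →ₗ[R] N'), Function.Injective f → Function.Injective (BalancedTensor.map M f)

/-- The right `R`-modules `M` of flat dimension at most `m`: those with an exact sequence
`0 → F m → ⋯ → F 1 → F 0 → M → 0` where all `F n` are flat (the sequence is continued by
zero modules `F n` for `n > m`). -/
def flatDimLE (R : Type u) [Ring R] (m : ℕ) : ObjectProperty (ModuleCat.{u} Rᵐᵒᵖ) := fun M ↦
  ∃ (F : ℕ → ModuleCat.{u} Rᵐᵒᵖ) (d : ∀ n, F (n + 1) →ₗ[Rᵐᵒᵖ] F n) (ε : F 0 →ₗ[Rᵐᵒᵖ] M),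
    (∀ n, IsFlatRight R (F n)) ∧
    (∀ n, m < n → Subsingleton (F n)) ∧
    (∀ n, Function.Exact (d (n + 1)) (d n)) ∧
    Function.Exact (d 0) ε ∧
    Function.Surjective ε

/-- The countably presentable right `R`-modules: the `ℵ₁`-presentable objects of the category
of right `R`-modules. -/
abbrev countablyPresentable (R : Type u) [Ring R] : ObjectProperty (ModuleCat.{u} Rᵐᵒᵖ) :=
  isCardinalPresentable (ModuleCat.{u} Rᵐᵒᵖ) (ℵ₁ : Cardinal.{u})

/-- A ring `R` is right countably coherent if every finitely generated right ideal of `R` is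
countably presentable as a right `R`-module. -/
def IsRightCountablyCoherent (R : Type u) [Ring R] : Prop :=
  ∀ I : Submodule Rᵐᵒᵖ R, I.FG → countablyPresentable R (ModuleCat.of Rᵐᵒᵖ I)

/-! All three claims rest on writing a module `M` of flat dimension at most `m` as an `ℵ₁`-directed
colimit of countably presentable modules of the same kind
(`HasFlatResolution.exists_directed_colimit`). Fix a free resolution of `M` with chosen bases. A
countable set of basis elements, taken from all degrees at once, is good if its spans form a
subcomplex that is exact in positive degrees and satisfies a factorization condition making its
`m`th syzygy flat. The cokernel in degree zero of such a subcomplex is countably presentable and has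
flat dimension at most `m`; these cokernels, indexed by the good sets under inclusion, have colimit
`M`.

Good sets are cofinal among countable sets (`FreeResolution.exists_isGood`): each condition asks,
for every finite set of basis elements, that countably many others be present, so it is reached by
closing off in countably many steps. Exactness is where coherence enters: the cycles supported on a
finite set of basis elements form a countably generated module
(`IsCountablyCoherent.inf_ker_finsupp`). Flatness becomes such a finitary condition through Lazard's
criterion, shown equivalent to the tensor definition, and the `m`th syzygy of `M` satisfies it by a
Schanuel argument (`HasFlatResolution.syzygy`).

Modules of flat dimension at most `m` are also closed under `ℵ₁`-filtered colimits, because a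
functorial syzygy commutes with these. Hence the inclusion into all modules preserves such colimits,
and countably presentable modules stay presentable in the subcategory. The colimit theorem then
yields an essentially small generator of presentable objects, whence accessibility; every
presentable object is a retract of a generating one, hence countably presentable as a module. -/

/-! ### Lazard's criterion and its permanence properties -/

section LazardFlat

variable {A : Type u} [Ring A] {M N : Type u} [AddCommGroup M] [Module A M]
  [AddCommGroup N] [Module A N]

variable (A M) in
/-- Lazard's criterion for flatness: a map from a free module to `M` which kills an element `l`
factors through a map of free modules which kills `l`. -/
def IsLazardFlat : Prop :=
  ∀ (X : Type u) (φ : (X →₀ A) →ₗ[A] M) (l : X →₀ A), φ l = 0 →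
    ∃ (κ : Type u) (α : (X →₀ A) →ₗ[A] (κ →₀ A)) (β : (κ →₀ A) →ₗ[A] M), β ∘ₗ α = φ ∧ α l = 0

namespace IsLazardFlat

theorem finsupp (X : Type u) : IsLazardFlat A (X →₀ A) := fun _ φ _ h ↦
  ⟨X, φ, LinearMap.id, LinearMap.id_comp _, h⟩

theorem of_linearEquiv (h : IsLazardFlat A M) (e : M ≃ₗ[A] N) : IsLazardFlat A N := by
  intro X φ l hl
  obtain ⟨κ, α, β, h₁, h₂⟩ := h X (e.symm.toLinearMap ∘ₗ φ) l (by simp [hl])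
  refine ⟨κ, α, e.toLinearMap ∘ₗ β, ?_, h₂⟩
  rw [LinearMap.comp_assoc, h₁]
  ext; simp

theorem of_basis {X : Type u} (b : Module.Basis X A M) : IsLazardFlat A M :=
  (finsupp X).of_linearEquiv b.repr.symm

theorem of_subsingleton [Subsingleton M] : IsLazardFlat A M := fun X _ _ _ ↦
  ⟨X, 0, 0, Subsingleton.elim _ _, rfl⟩

/-- The element `l` has finite support, so the criterion is applied to the basis elements in the
support alone; each other basis element is carried along as a new basis element of the target. -/
theorem of_finite
    (h : ∀ (X : Type u) [Finite X] (φ : (X →₀ A) →ₗ[A] M) (l : X →₀ A), φ l = 0 →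
      ∃ (κ : Type u) (α : (X →₀ A) →ₗ[A] (κ →₀ A)) (β : (κ →₀ A) →ₗ[A] M),
        β ∘ₗ α = φ ∧ α l = 0) : IsLazardFlat A M := by
  classical
  intro X φ l hl
  let s : Set X := l.support
  let j : (s →₀ A) →ₗ[A] (X →₀ A) := Finsupp.lmapDomain A A Subtype.val
  have : Finite s := l.support.finite_toSet
  obtain ⟨l', hl'⟩ : ∃ l', j l' = l := by
    have : l ∈ Finsupp.supported A A s := fun x hx ↦ hx
    rw [← Subtype.range_coe (s := s), ← Set.image_univ, ← Finsupp.lmapDomain_supported] at this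
    obtain ⟨l', -, h⟩ := this
    exact ⟨l', h⟩
  obtain ⟨κ, α, β, h₁, h₂⟩ := h s (φ ∘ₗ j) l' (by simpa [hl'] using hl)
  let i₁ : (κ →₀ A) →ₗ[A] (κ ⊕ X →₀ A) := Finsupp.lmapDomain A A Sum.inl
  let α' : (X →₀ A) →ₗ[A] (κ ⊕ X →₀ A) := Finsupp.linearCombination A fun x ↦
    if hx : x ∈ s then i₁ (α (Finsupp.single ⟨x, hx⟩ 1)) else Finsupp.single (Sum.inr x) 1
  let β' : (κ ⊕ X →₀ A) →ₗ[A] M := Finsupp.linearCombination A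
    (Sum.elim (fun k ↦ β (Finsupp.single k 1)) fun x ↦ φ (Finsupp.single x 1))
  have hi : β' ∘ₗ i₁ = β := by ext; simp [β', i₁]
  have hj : α' ∘ₗ j = i₁ ∘ₗ α := by
    ext1 x
    ext1
    simp [α', j]
  refine ⟨_, α', β', ?_, ?_⟩
  · ext x
    by_cases hx : x ∈ s
    · have e₁ := LinearMap.congr_fun hi (α (Finsupp.single ⟨x, hx⟩ 1))
      have e₂ := LinearMap.congr_fun h₁ (Finsupp.single ⟨x, hx⟩ 1)
      simp only [LinearMap.comp_apply] at e₁ e₂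
      simp [α', hx, e₁, e₂, j]
    · simp [α', β', hx]
  · rw [← hl', ← LinearMap.comp_apply, hj, LinearMap.comp_apply, h₂, map_zero]

/-- Apply the criterion repeatedly, each time to the image in the free module reached so far of the
next element to be killed. -/
theorem exists_factor (h : IsLazardFlat A M) {X : Type u} (φ : (X →₀ A) →ₗ[A] M)
    (L : Finset (X →₀ A)) (hL : ∀ l ∈ L, φ l = 0) :
    ∃ (κ : Type u) (α : (X →₀ A) →ₗ[A] (κ →₀ A)) (β : (κ →₀ A) →ₗ[A] M),
      β ∘ₗ α = φ ∧ ∀ l ∈ L, α l = 0 := by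
  classical
  induction L using Finset.induction_on with
  | empty => exact ⟨X, LinearMap.id, φ, LinearMap.comp_id _, by simp⟩
  | insert l L _ ih =>
    obtain ⟨κ, α, β, h₁, h₂⟩ := ih fun l hl ↦ hL l (Finset.mem_insert_of_mem hl)
    obtain ⟨μ, α', β', h₃, h₄⟩ := h κ β (α l) (by
      rw [← LinearMap.comp_apply, h₁]; exact hL l (Finset.mem_insert_self _ _))
    refine ⟨μ, α' ∘ₗ α, β', by rw [← LinearMap.comp_assoc, h₃, h₁], fun x hx ↦ ?_⟩
    obtain rfl | hx := Finset.mem_insert.1 hx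
    · exact h₄
    · simp [h₂ x hx]

theorem prod (hM : IsLazardFlat A M) (hN : IsLazardFlat A N) : IsLazardFlat A (M × N) := by
  intro X φ l hl
  obtain ⟨κ, α, β, h₁, h₂⟩ := hM X (LinearMap.fst A M N ∘ₗ φ) l (by simp [hl])
  obtain ⟨μ, α', β', h₃, h₄⟩ := hN X (LinearMap.snd A M N ∘ₗ φ) l (by simp [hl])
  let e := Finsupp.sumFinsuppLEquivProdFinsupp (M := A) A (α := κ) (β := μ)
  refine ⟨κ ⊕ μ, e.symm.toLinearMap ∘ₗ α.prod α', β.prodMap β' ∘ₗ e.toLinearMap, ?_, ?_⟩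
  · refine LinearMap.ext fun x ↦ ?_
    have e₁ := LinearMap.congr_fun h₁ x
    have e₂ := LinearMap.congr_fun h₃ x
    simp only [LinearMap.comp_apply, LinearMap.fst_apply, LinearMap.snd_apply] at e₁ e₂
    simp [e₁, e₂]
  · simp [h₂, h₄]

/-- The kernel of a surjective map between flat modules is flat. -/
theorem of_exact {K Q F : Type u} [AddCommGroup K] [Module A K] [AddCommGroup Q] [Module A Q]
    [AddCommGroup F] [Module A F] (hQ : IsLazardFlat A Q) (hF : IsLazardFlat A F)
    {i : K →ₗ[A] Q} {p : Q →ₗ[A] F} (hi : Function.Injective i) (hip : Function.Exact i p)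
    (hp : Function.Surjective p) : IsLazardFlat A K := by
  classical
  refine of_finite fun X _ φ l hl ↦ ?_
  have := Fintype.ofFinite X
  obtain ⟨κ, α, β, h₁, h₂⟩ := hQ X (i ∘ₗ φ) l (by simp [hl])
  have h₁' (x) : β (α x) = i (φ x) := LinearMap.congr_fun h₁ x
  -- The map `β` need not land in `K`. Flatness of `F` factors `p ∘ β` through some `γ` that kills
  -- the image of `α`, which is possible because `X` is finite. Subtracting from `β` a lift of this
  -- factorization moves it into the kernel of `p` without changing it on the image of `α`.
  obtain ⟨μ, γ, δ, h₃, h₄⟩ := hF.exists_factor (p ∘ₗ β)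
    (Finset.univ.image fun x ↦ α (Finsupp.single x 1)) (by simp [h₁', hip.apply_apply_eq_zero])
  obtain ⟨δ', hδ⟩ := Module.projective_lifting_property p δ hp
  have h₅ (x) : p ((β - δ' ∘ₗ γ) x) = 0 := by
    have e₁ := LinearMap.congr_fun h₃ x
    have e₂ := LinearMap.congr_fun hδ (γ x)
    simp only [LinearMap.comp_apply] at e₁ e₂
    simp [e₁, e₂]
  have hγ : γ ∘ₗ α = 0 := by
    ext1 x; ext1
    simpa using h₄ _ (Finset.mem_image_of_mem _ (Finset.mem_univ x))
  choose b hb using fun k ↦ (hip _).1 (h₅ (Finsupp.single k 1))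
  have hib : i ∘ₗ Finsupp.linearCombination A b = β - δ' ∘ₗ γ := by
    ext1 x; ext1; simp [hb]
  refine ⟨κ, α, Finsupp.linearCombination A b, LinearMap.ext fun x ↦ hi ?_, h₂⟩
  have e₁ := LinearMap.congr_fun hib (α x)
  have e₂ := LinearMap.congr_fun hγ x
  simp only [LinearMap.comp_apply] at e₁ e₂
  simp [e₁, e₂, h₁']

end IsLazardFlat

end LazardFlat

/-! ### Flat resolutions and dimension shifting -/

section FlatDimension

variable {A : Type u} [Ring A]

/-- Modules with a flat resolution of length at most `m`, by recursion on `m`. -/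
def HasFlatResolution : ℕ → ModuleCat.{u} A → Prop
  | 0, M => IsLazardFlat A M
  | m + 1, M => ∃ (K F : ModuleCat.{u} A) (i : K →ₗ[A] F) (p : F →ₗ[A] M),
      Function.Injective i ∧ Function.Exact i p ∧ Function.Surjective p ∧
        IsLazardFlat A F ∧ HasFlatResolution m K

namespace HasFlatResolution

theorem of_linearEquiv {m : ℕ} {M N : ModuleCat.{u} A} (h : HasFlatResolution m M)
    (e : M ≃ₗ[A] N) : HasFlatResolution m N := by
  cases m with
  | zero => exact IsLazardFlat.of_linearEquiv h e
  | succ m =>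
    obtain ⟨K, F, i, p, hi, hip, hp, hF, hK⟩ := h
    exact ⟨K, F, i, e.toLinearMap ∘ₗ p, hi, fun x ↦ by simp [hip x], e.surjective.comp hp, hF, hK⟩

theorem prod {m : ℕ} {M N : ModuleCat.{u} A} (h : HasFlatResolution m M)
    (hN : IsLazardFlat A N) : HasFlatResolution m (ModuleCat.of A (M × N)) := by
  cases m with
  | zero => exact IsLazardFlat.prod h hN
  | succ m =>
    obtain ⟨K, F, i, p, hi, hip, hp, hF, hK⟩ := h
    refine ⟨K, ModuleCat.of A (F × N), LinearMap.inl A F N ∘ₗ i, p.prodMap LinearMap.id,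
      LinearMap.inl_injective.comp hi, fun x ↦ ?_, hp.prodMap Function.surjective_id,
      hF.prod hN, hK⟩
    obtain ⟨x, y⟩ := x
    simp only [LinearMap.prodMap_apply, LinearMap.id_apply, Prod.mk_eq_zero, hip x, Set.mem_range,
      LinearMap.comp_apply, LinearMap.inl_apply, Prod.mk.injEq]
    constructor
    · rintro ⟨⟨z, rfl⟩, rfl⟩
      exact ⟨z, rfl, rfl⟩
    · rintro ⟨z, rfl, rfl⟩
      exact ⟨⟨z, rfl⟩, rfl⟩

/-- Only the first term of the resolution of `Q` has to change: replace `G` by the kernel of `G → Q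
→ F`, which is flat as the kernel of a surjection between flat modules and still contains `L`. -/
theorem of_exact {m : ℕ} {K Q F : ModuleCat.{u} A} (hQ : HasFlatResolution m Q)
    (hF : IsLazardFlat A F) {i : K →ₗ[A] Q} {p : Q →ₗ[A] F} (hi : Function.Injective i)
    (hip : Function.Exact i p) (hp : Function.Surjective p) : HasFlatResolution m K := by
  cases m with
  | zero => exact IsLazardFlat.of_exact hQ hF hi hip hp
  | succ m =>
    obtain ⟨L, G, j, q, hj, hjq, hq, hG, hL⟩ := hQ
    let G' := LinearMap.ker (p ∘ₗ q)
    have hG' : IsLazardFlat A G' := hG.of_exact hF (i := G'.subtype) (p := p ∘ₗ q)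
      Subtype.val_injective (LinearMap.exact_subtype_ker_map _) (hp.comp hq)
    let e : K ≃ₗ[A] LinearMap.range i := LinearEquiv.ofInjective i hi
    have hr (x : G') : q x.1 ∈ LinearMap.range i := (hip _).1 x.2
    have hrs : Function.Surjective ((q ∘ₗ G'.subtype).codRestrict _ hr) := by
      rintro ⟨_, x, rfl⟩
      obtain ⟨y, hy⟩ := hq (i x)
      exact ⟨⟨y, by simp [G', hy, hip.apply_apply_eq_zero]⟩, Subtype.ext hy⟩
    have hl (x : L) : j x ∈ G' := by simp [G', hjq.apply_apply_eq_zero]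
    refine HasFlatResolution.of_linearEquiv (M := ModuleCat.of A (LinearMap.range i))
      ⟨L, ModuleCat.of A G', j.codRestrict _ hl, (q ∘ₗ G'.subtype).codRestrict _ hr,
      fun x y h ↦ hj (congrArg Subtype.val h), fun x ↦ ?_, hrs, hG', hL⟩ e.symm
    rw [← Subtype.val_inj]
    refine (hjq x.1).trans ⟨?_, ?_⟩
    · rintro ⟨y, hy⟩
      exact ⟨y, Subtype.ext hy⟩
    · rintro ⟨y, rfl⟩
      exact ⟨y, rfl⟩

/-- Schanuel's argument: lift `P → M` to `f : P → F`. Then `K` is the kernel of the surjection `L ×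
P → F`, and both `of_exact` and `prod` apply. -/
theorem syzygy {m : ℕ} {M K : ModuleCat.{u} A} (hM : HasFlatResolution (m + 1) M) {P : Type u}
    [AddCommGroup P] [Module A P] [Module.Projective A P] (hP : IsLazardFlat A P)
    {i : K →ₗ[A] P} {p : P →ₗ[A] M} (hi : Function.Injective i)
    (hip : Function.Exact i p) (hp : Function.Surjective p) : HasFlatResolution m K := by
  obtain ⟨L, F, j, q, hj, hjq, hq, hF, hL⟩ := hM
  obtain ⟨f, hf⟩ := Module.projective_lifting_property q p hq
  have hf' (x) : q (f x) = p x := LinearMap.congr_fun hf x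
  have hK (x : K) : ∃ y, j y = f (i x) := (hjq _).1 (by rw [hf', hip.apply_apply_eq_zero])
  let e : L ≃ₗ[A] LinearMap.range j := LinearEquiv.ofInjective j hj
  let r : K →ₗ[A] L := e.symm.toLinearMap ∘ₗ (f ∘ₗ i).codRestrict (LinearMap.range j) hK
  have hr (x) : j (r x) = f (i x) := congrArg Subtype.val
    (e.apply_symm_apply ((f ∘ₗ i).codRestrict (LinearMap.range j) hK x))
  refine of_exact (Q := ModuleCat.of A (L × P))
    (hL.prod (N := ModuleCat.of A P) hP) hF
    (i := (-r).prod i) (p := j.coprod f) (fun x y h ↦ hi (congrArg Prod.snd h)) ?_ ?_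
  · rintro ⟨x, y⟩
    constructor
    · intro h
      replace h : j x + f y = 0 := h
      obtain ⟨z, rfl⟩ : ∃ z, i z = y := (hip _).1 (by
        simpa [hjq.apply_apply_eq_zero, hf'] using congrArg q h)
      refine ⟨z, Prod.ext (hj ?_) rfl⟩
      simp [hr, eq_neg_of_add_eq_zero_left h]
    · rintro ⟨z, h⟩
      obtain ⟨rfl, rfl⟩ := Prod.ext_iff.1 h
      simp [hr]
  · intro x
    obtain ⟨y, hy⟩ := hp (q x)
    obtain ⟨z, hz⟩ := (hjq (x - f y)).1 (by simp [hf', hy])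
    exact ⟨(z, y), by simp [hz]⟩

end HasFlatResolution

end FlatDimension

/-! ### Right exactness of the balanced tensor product, and free modules -/

section BalancedTensor

variable {R : Type*} [Ring R]

theorem rTensor_mem_balancedRelations {M M' : Type*} (N : Type*) [AddCommGroup M] [Module Rᵐᵒᵖ M]
    [AddCommGroup M'] [Module Rᵐᵒᵖ M'] [AddCommGroup N] [Module R N] (f : M →ₗ[Rᵐᵒᵖ] M')
    {t : M ⊗[ℤ] N} (ht : t ∈ balancedRelations R M N) :
    LinearMap.rTensor N f.toAddMonoidHom.toIntLinearMap t ∈ balancedRelations R M' N := by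
  suffices balancedRelations R M N ≤ (balancedRelations R M' N).comap
      (LinearMap.rTensor N f.toAddMonoidHom.toIntLinearMap).toAddMonoidHom from this ht
  refine (AddSubgroup.closure_le _).2 ?_
  rintro _ ⟨m, r, n, rfl⟩
  exact AddSubgroup.subset_closure ⟨f m, r, n, by simp⟩

theorem BalancedTensor.map_injective_iff {M N N' : Type*} [AddCommGroup M] [Module Rᵐᵒᵖ M]
    [AddCommGroup N] [Module R N] [AddCommGroup N'] [Module R N'] (f : N →ₗ[R] N') :
    Function.Injective (BalancedTensor.map M f) ↔
      ∀ t : M ⊗[ℤ] N, LinearMap.lTensor M f.toAddMonoidHom.toIntLinearMap t ∈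
        balancedRelations R M N' → t ∈ balancedRelations R M N := by
  rw [injective_iff_map_eq_zero]
  refine ⟨fun h t ht ↦ ?_, fun h t ↦ ?_⟩
  · exact (QuotientAddGroup.eq_zero_iff t).1 (h t ((QuotientAddGroup.eq_zero_iff _).2 ht))
  · obtain ⟨t, rfl⟩ := QuotientAddGroup.mk_surjective t
    exact fun ht ↦ (QuotientAddGroup.eq_zero_iff t).2 (h t ((QuotientAddGroup.eq_zero_iff _).1 ht))

/-- Right exactness of the balanced tensor product in the second variable. -/
theorem exists_sub_lTensor_mem_balancedRelations (M : Type*) {K L I : Type*} [AddCommGroup M]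
    [Module Rᵐᵒᵖ M] [AddCommGroup K] [Module R K] [AddCommGroup L] [Module R L]
    [AddCommGroup I] [Module R I] {k : K →ₗ[R] L} {g : L →ₗ[R] I} (hkg : Function.Exact k g)
    (hg : Function.Surjective g) (t : M ⊗[ℤ] L)
    (ht : LinearMap.lTensor M g.toAddMonoidHom.toIntLinearMap t ∈ balancedRelations R M I) :
    ∃ s : M ⊗[ℤ] K, t - LinearMap.lTensor M k.toAddMonoidHom.toIntLinearMap s ∈
      balancedRelations R M L := by
  have h : balancedRelations R M I ≤ (balancedRelations R M L).map
      (LinearMap.lTensor M g.toAddMonoidHom.toIntLinearMap).toAddMonoidHom := by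
    refine (AddSubgroup.closure_le _).2 ?_
    rintro _ ⟨m, r, n, rfl⟩
    obtain ⟨n, rfl⟩ := hg n
    exact ⟨_, AddSubgroup.subset_closure ⟨m, r, n, rfl⟩, by simp⟩
  obtain ⟨b, hb, hbt⟩ := h ht
  replace hbt : LinearMap.lTensor M g.toAddMonoidHom.toIntLinearMap b =
    LinearMap.lTensor M g.toAddMonoidHom.toIntLinearMap t := hbt
  obtain ⟨s, hs⟩ := (lTensor_exact M (f := k.toAddMonoidHom.toIntLinearMap)
    (g := g.toAddMonoidHom.toIntLinearMap) hkg hg (t - b)).1 (by rw [map_sub, hbt, sub_self])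
  exact ⟨s, by rwa [hs, sub_sub_cancel]⟩

/-- Right exactness of the balanced tensor product in the first variable. -/
theorem exists_sub_rTensor_mem_balancedRelations {K L I : Type*} (N : Type*) [AddCommGroup N]
    [Module R N] [AddCommGroup K] [Module Rᵐᵒᵖ K] [AddCommGroup L] [Module Rᵐᵒᵖ L]
    [AddCommGroup I] [Module Rᵐᵒᵖ I] {k : K →ₗ[Rᵐᵒᵖ] L} {g : L →ₗ[Rᵐᵒᵖ] I}
    (hkg : Function.Exact k g) (hg : Function.Surjective g) (t : L ⊗[ℤ] N)
    (ht : LinearMap.rTensor N g.toAddMonoidHom.toIntLinearMap t ∈ balancedRelations R I N) :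
    ∃ s : K ⊗[ℤ] N, t - LinearMap.rTensor N k.toAddMonoidHom.toIntLinearMap s ∈
      balancedRelations R L N := by
  have h : balancedRelations R I N ≤ (balancedRelations R L N).map
      (LinearMap.rTensor N g.toAddMonoidHom.toIntLinearMap).toAddMonoidHom := by
    refine (AddSubgroup.closure_le _).2 ?_
    rintro _ ⟨m, r, n, rfl⟩
    obtain ⟨m, rfl⟩ := hg m
    exact ⟨_, AddSubgroup.subset_closure ⟨m, r, n, rfl⟩, by simp⟩
  obtain ⟨b, hb, hbt⟩ := h ht
  replace hbt : LinearMap.rTensor N g.toAddMonoidHom.toIntLinearMap b =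
    LinearMap.rTensor N g.toAddMonoidHom.toIntLinearMap t := hbt
  obtain ⟨s, hs⟩ := (rTensor_exact N (f := k.toAddMonoidHom.toIntLinearMap)
    (g := g.toAddMonoidHom.toIntLinearMap) hkg hg (t - b)).1 (by rw [map_sub, hbt, sub_self])
  exact ⟨s, by rwa [hs, sub_sub_cancel]⟩

/-- The evaluation `R^κ ⊗ N → N^κ` for a free right module `R^κ`. -/
noncomputable def balancedTensorFinsupp (R : Type*) [Ring R] (κ N : Type*) [AddCommGroup N]
    [Module R N] : (κ →₀ Rᵐᵒᵖ) ⊗[ℤ] N →+ (κ →₀ N) :=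
  TensorProduct.liftAddHom
    (Finsupp.liftAddHom fun k ↦ AddMonoidHom.mk'
      (fun a ↦ (Finsupp.singleAddHom k).comp (DistribSMul.toAddMonoidHom N a.unop))
      fun a b ↦ by ext1 x; simp [add_smul])
    fun r m n ↦ by rw [map_zsmul, map_zsmul]; rfl

@[simp]
theorem balancedTensorFinsupp_single_tmul {κ N : Type*} [AddCommGroup N] [Module R N]
    (k : κ) (a : Rᵐᵒᵖ) (n : N) :
    balancedTensorFinsupp R κ N (Finsupp.single k a ⊗ₜ n) = Finsupp.single k (a.unop • n) := by
  simp [balancedTensorFinsupp]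

theorem tensor_finsupp_induction {κ N : Type*} [AddCommGroup N]
    {p : (κ →₀ Rᵐᵒᵖ) ⊗[ℤ] N → Prop} (t : (κ →₀ Rᵐᵒᵖ) ⊗[ℤ] N)
    (h₁ : ∀ k a n, p (Finsupp.single k a ⊗ₜ n)) (h₀ : p 0)
    (h₂ : ∀ s t, p s → p t → p (s + t)) : p t := by
  induction t with
  | zero => exact h₀
  | add s t hs ht => exact h₂ s t hs ht
  | tmul x n =>
    induction x using Finsupp.induction_linear with
    | zero => rwa [TensorProduct.zero_tmul]
    | add x y hx hy => rw [TensorProduct.add_tmul]; exact h₂ _ _ hx hy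
    | single k a => exact h₁ k a n

theorem mem_balancedRelations_finsupp_iff {κ N : Type*} [AddCommGroup N] [Module R N]
    (t : (κ →₀ Rᵐᵒᵖ) ⊗[ℤ] N) :
    t ∈ balancedRelations R (κ →₀ Rᵐᵒᵖ) N ↔ balancedTensorFinsupp R κ N t = 0 := by
  constructor
  · intro ht
    suffices balancedRelations R (κ →₀ Rᵐᵒᵖ) N ≤ (balancedTensorFinsupp R κ N).ker from this ht
    refine (AddSubgroup.closure_le _).2 ?_
    rintro _ ⟨m, r, n, rfl⟩
    simp only [SetLike.mem_coe, AddMonoidHom.mem_ker]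
    induction m using Finsupp.induction_linear with
    | zero => simp
    | add x y hx hy =>
      rw [smul_add, TensorProduct.add_tmul, TensorProduct.add_tmul, add_sub_add_comm, map_add,
        hx, hy, add_zero]
    | single k a =>
      rw [Finsupp.smul_single, map_sub, balancedTensorFinsupp_single_tmul,
        balancedTensorFinsupp_single_tmul]
      simp [mul_smul]
  · intro ht
    -- Modulo the balancing relations `σ` inverts the evaluation, since every scalar can be moved to
    -- the right factor.
    let σ : (κ →₀ N) →+ (κ →₀ Rᵐᵒᵖ) ⊗[ℤ] N := Finsupp.liftAddHom fun k ↦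
      (TensorProduct.mk ℤ (κ →₀ Rᵐᵒᵖ) N (Finsupp.single k 1)).toAddMonoidHom
    have h (t) : t - σ (balancedTensorFinsupp R κ N t) ∈ balancedRelations R (κ →₀ Rᵐᵒᵖ) N := by
      induction t using tensor_finsupp_induction with
      | h₁ k a n =>
        refine AddSubgroup.subset_closure ⟨Finsupp.single k 1, a.unop, n, ?_⟩
        simp [σ]
      | h₀ => simp
      | h₂ s t hs ht =>
        rw [map_add, map_add, add_sub_add_comm]
        exact add_mem hs ht
    simpa [ht] using h t

end BalancedTensor

/-! ### Flatness by tensor products is equivalent to Lazard's criterion -/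

section Flat

variable {R : Type u} [Ring R]

theorem isFlatRight_finsupp (κ : Type u) : IsFlatRight R (κ →₀ Rᵐᵒᵖ) := by
  intro N N' _ _ _ _ f hf
  rw [BalancedTensor.map_injective_iff]
  intro t ht
  rw [mem_balancedRelations_finsupp_iff] at ht ⊢
  have h (t) : balancedTensorFinsupp R κ N' (LinearMap.lTensor _ f.toAddMonoidHom.toIntLinearMap t) =
      Finsupp.mapRange.addMonoidHom f.toAddMonoidHom (balancedTensorFinsupp R κ N t) := by
    induction t using tensor_finsupp_induction with
    | h₁ k a n => simp
    | h₀ => simp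
    | h₂ s t hs ht => simp only [map_add, hs, ht]
  refine Finsupp.mapRange_injective f (map_zero f) hf ?_
  rw [h] at ht
  simpa using ht

variable {M : Type u} [AddCommGroup M] [Module Rᵐᵒᵖ M]

/-- Lift `t` to a free module covering `M`. Its image in `N'` vanishes up to balancing relations and
finitely many tensors with first factor in `ker π`. A factorization of `π` that kills these first
factors moves the question to a free module, where injectivity is coordinatewise. -/
theorem IsLazardFlat.isFlatRight (h : IsLazardFlat Rᵐᵒᵖ M) : IsFlatRight R M := by
  classical
  intro N N' _ _ _ _ f hf
  rw [BalancedTensor.map_injective_iff]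
  intro t ht
  let π : (M →₀ Rᵐᵒᵖ) →ₗ[Rᵐᵒᵖ] M := Finsupp.linearCombination Rᵐᵒᵖ id
  have hπ : Function.Surjective π := Finsupp.linearCombination_id_surjective _ _
  obtain ⟨t, rfl⟩ := LinearMap.rTensor_surjective N (g := π.toAddMonoidHom.toIntLinearMap) hπ t
  rw [← LinearMap.comp_apply, LinearMap.lTensor_comp_rTensor, ← LinearMap.rTensor_comp_lTensor,
    LinearMap.comp_apply] at ht
  obtain ⟨s, hs⟩ := exists_sub_rTensor_mem_balancedRelations N'
    (K := LinearMap.ker π) (L := M →₀ Rᵐᵒᵖ)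
    (k := (LinearMap.ker π).subtype) (g := π)
    (LinearMap.exact_subtype_ker_map π) hπ _ ht
  obtain ⟨S, rfl⟩ := TensorProduct.exists_finset s
  obtain ⟨κ, α, β, h₁, h₂⟩ := h.exists_factor π (S.image fun x ↦ x.1.1) (by
    intro l hl
    obtain ⟨x, -, rfl⟩ := Finset.mem_image.1 hl
    exact x.1.2)
  have e : LinearMap.rTensor N π.toAddMonoidHom.toIntLinearMap t =
      LinearMap.rTensor N β.toAddMonoidHom.toIntLinearMap
        (LinearMap.rTensor N α.toAddMonoidHom.toIntLinearMap t) := by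
    rw [← LinearMap.comp_apply, ← LinearMap.rTensor_comp]
    congr 2
    exact LinearMap.ext fun x ↦ (LinearMap.congr_fun h₁ x).symm
  rw [e]
  refine rTensor_mem_balancedRelations N β
    ((BalancedTensor.map_injective_iff f).1 (isFlatRight_finsupp κ N N' f hf) _ ?_)
  have h₃ := rTensor_mem_balancedRelations N' α hs
  rw [map_sub, map_sum, map_sum, Finset.sum_eq_zero, sub_zero, ← LinearMap.comp_apply,
    LinearMap.rTensor_comp_lTensor] at h₃
  · rwa [← LinearMap.comp_apply, LinearMap.lTensor_comp_rTensor]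
  · intro x hx
    have : α x.1.1 = 0 := h₂ _ (Finset.mem_image_of_mem _ hx)
    simp [this]

/-- The equational criterion. The relation `l` defines `g : R^X → R`, and `M ⊗ g` kills `t = ∑ φ(eᵢ)
⊗ eᵢ`. Flatness for the inclusion of the range of `g`, with right exactness, puts `t` in the image
of `M ⊗ ker g`; the coordinates of such an expression give the factorization. -/
theorem IsFlatRight.isLazardFlat (h : IsFlatRight R M) : IsLazardFlat Rᵐᵒᵖ M := by
  classical
  refine IsLazardFlat.of_finite fun X _ φ l hl ↦ ?_
  have := Fintype.ofFinite X
  let g : (X → R) →ₗ[R] R := Fintype.linearCombination R fun i ↦ (l i).unop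
  let t : M ⊗[ℤ] (X → R) := ∑ i, φ (Finsupp.single i 1) ⊗ₜ Pi.single i 1
  have hl' : ∑ i, l i • φ (Finsupp.single i 1) = 0 := by
    rw [← hl]
    conv_rhs => rw [← Finsupp.univ_sum_single l]
    rw [map_sum]
    refine Finset.sum_congr rfl fun i _ ↦ ?_
    rw [← map_smul]
    simp
  have ht : LinearMap.lTensor M g.toAddMonoidHom.toIntLinearMap t ∈ balancedRelations R M R := by
    have e : LinearMap.lTensor M g.toAddMonoidHom.toIntLinearMap t =
        -∑ i, ((l i • φ (Finsupp.single i 1)) ⊗ₜ[ℤ] (1 : R) -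
          φ (Finsupp.single i 1) ⊗ₜ (l i).unop) := by
      rw [Finset.sum_sub_distrib, ← TensorProduct.sum_tmul, hl']
      simp [t, g, Fintype.linearCombination_apply_single]
    rw [e]
    refine neg_mem (sum_mem fun i _ ↦ AddSubgroup.subset_closure
      ⟨φ (Finsupp.single i 1), (l i).unop, 1, by simp⟩)
  obtain ⟨s, hs⟩ := exists_sub_lTensor_mem_balancedRelations M (k := (LinearMap.ker g).subtype)
    (g := g.rangeRestrict) (fun x ↦ by simp [← Subtype.val_inj]) g.surjective_rangeRestrict t
    ((BalancedTensor.map_injective_iff _).1 (h _ _ (LinearMap.range g).subtype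
      Subtype.val_injective) _ (by
        rw [← LinearMap.comp_apply, ← LinearMap.lTensor_comp]
        exact ht))
  obtain ⟨S, rfl⟩ := TensorProduct.exists_finset s
  let ψ (i : X) : M ⊗[ℤ] (X → R) →+ M := TensorProduct.liftAddHom
    (AddMonoidHom.mk' (fun m ↦ AddMonoidHom.mk' (fun r ↦ MulOpposite.op (r i) • m)
      fun a b ↦ by simp [add_smul]) fun a b ↦ AddMonoidHom.ext fun r ↦ by simp) fun r m n ↦ by
        rw [map_zsmul, map_zsmul]; rfl
  have hψ (i) : balancedRelations R M (X → R) ≤ (ψ i).ker := by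
    refine (AddSubgroup.closure_le _).2 ?_
    rintro _ ⟨m, r, n, rfl⟩
    simp [ψ, mul_smul]
  have hS (i) : φ (Finsupp.single i 1) = ∑ p ∈ S, MulOpposite.op (p.2.1 i) • p.1 := by
    have := hψ i hs
    rw [AddMonoidHom.mem_ker, map_sub, sub_eq_zero] at this
    simpa [t, ψ, Pi.single_apply, ite_smul, apply_ite MulOpposite.op] using this
  -- The free module is indexed by all pairs only for convenience; just the pairs in the finite set
  -- `S` occur. That `α` kills `l` says exactly that their second components lie in `ker g`.
  refine ⟨M × LinearMap.ker g, Finsupp.linearCombination Rᵐᵒᵖ fun i ↦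
    ∑ p ∈ S, Finsupp.single p (MulOpposite.op (p.2.1 i)),
    Finsupp.linearCombination Rᵐᵒᵖ Prod.fst, ?_, ?_⟩
  · ext i
    simp [hS]
  · rw [Finsupp.linearCombination_apply, Finsupp.sum_fintype _ _ (by simp)]
    simp only [Finset.smul_sum, Finsupp.smul_single]
    rw [Finset.sum_comm]
    refine Finset.sum_eq_zero fun p _ ↦ ?_
    rw [← Finsupp.single_finsetSum]
    have : ∑ i, p.2.1 i * (l i).unop = 0 := by
      have := p.2.2
      rw [LinearMap.mem_ker, Fintype.linearCombination_apply] at this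
      exact this
    have := congrArg MulOpposite.op this
    simp only [MulOpposite.op_zero, Finset.op_sum, MulOpposite.op_mul, MulOpposite.op_unop] at this
    simp [this]

end Flat

/-! ### Long resolutions versus recursive ones -/

section FlatDimLE

variable {R : Type u} [Ring R]

theorem HasFlatResolution.flatDimLE {m : ℕ} {M : ModuleCat.{u} Rᵐᵒᵖ}
    (h : HasFlatResolution m M) : flatDimLE R m M := by
  induction m generalizing M with
  | zero =>
    let F : ℕ → ModuleCat.{u} Rᵐᵒᵖ := fun n ↦ match n with
      | 0 => M
      | _ + 1 => ModuleCat.of _ PUnit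
    have hF (n) : Subsingleton (F (n + 1)) := inferInstanceAs (Subsingleton PUnit)
    refine ⟨F, fun _ ↦ 0, (LinearMap.id : M →ₗ[Rᵐᵒᵖ] M), ?_, ?_, ?_, ?_, Function.surjective_id⟩
    · rintro (_ | n)
      · exact IsLazardFlat.isFlatRight h
      · exact IsLazardFlat.isFlatRight .of_subsingleton
    · rintro (_ | n) hn
      · omega
      · exact hF n
    · exact fun n x ↦ ⟨fun _ ↦ ⟨0, Subsingleton.elim _ _⟩, fun _ ↦ rfl⟩
    · exact fun x ↦ ⟨fun h ↦ ⟨0, h.symm⟩, fun ⟨_, h⟩ ↦ h.symm⟩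
  | succ m ih =>
    obtain ⟨K, F₀, i, p, hi, hip, hp, hF₀, hK⟩ := h
    obtain ⟨F, d, ε, h₁, h₂, h₃, h₄, h₅⟩ := ih hK
    let G : ℕ → ModuleCat.{u} Rᵐᵒᵖ := fun n ↦ match n with
      | 0 => F₀
      | n + 1 => F n
    let δ : ∀ n, (G (n + 1) : Type u) →ₗ[Rᵐᵒᵖ] (G n : Type u) := fun n ↦ match n with
      | 0 => i ∘ₗ ε
      | n + 1 => d n
    refine ⟨G, δ, p, ?_, ?_, ?_, ?_, hp⟩
    · rintro (_ | n)
      · exact hF₀.isFlatRight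
      · exact h₁ n
    · rintro (_ | n) hn
      · omega
      · exact h₂ n (by omega)
    · rintro (_ | n)
      · intro x
        refine Iff.trans ?_ (h₄ x)
        exact map_eq_zero_iff i hi
      · exact h₃ n
    · intro x
      refine (hip x).trans ⟨?_, ?_⟩
      · rintro ⟨y, rfl⟩
        obtain ⟨z, rfl⟩ := h₅ y
        exact ⟨z, rfl⟩
      · rintro ⟨z, rfl⟩
        exact ⟨ε z, rfl⟩

theorem flatDimLE.hasFlatResolution {m : ℕ} {M : ModuleCat.{u} Rᵐᵒᵖ}
    (h : flatDimLE R m M) : HasFlatResolution m M := by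
  induction m generalizing M with
  | zero =>
    obtain ⟨F, d, ε, h₁, h₂, h₃, h₄, h₅⟩ := h
    have := h₂ 1 one_pos
    refine IsLazardFlat.of_linearEquiv (h₁ 0).isLazardFlat (LinearEquiv.ofBijective ε ⟨?_, h₅⟩)
    refine (injective_iff_map_eq_zero ε).2 fun x hx ↦ ?_
    obtain ⟨y, rfl⟩ := (h₄ x).1 hx
    rw [Subsingleton.elim y 0, map_zero]
  | succ m ih =>
    obtain ⟨F, d, ε, h₁, h₂, h₃, h₄, h₅⟩ := h
    have h₀ (x) : d 0 x ∈ LinearMap.ker ε := h₄.apply_apply_eq_zero x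
    refine ⟨ModuleCat.of _ (LinearMap.ker ε), F 0, (LinearMap.ker ε).subtype, ε,
      Subtype.val_injective, LinearMap.exact_subtype_ker_map ε, h₅, (h₁ 0).isLazardFlat,
      ih ⟨fun n ↦ F (n + 1), fun n ↦ d (n + 1), (d 0).codRestrict _ h₀, fun n ↦ h₁ _,
        fun n hn ↦ h₂ _ (by omega), fun n ↦ h₃ _, fun x ↦ ?_, ?_⟩⟩
    · rw [← h₃ 0 x, ← Subtype.val_inj]
      rfl
    · rintro ⟨x, hx⟩
      obtain ⟨y, rfl⟩ := (h₄ x).1 hx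
      exact ⟨y, rfl⟩

end FlatDimLE

open Limits

/-! ### Elementwise colimits, and closure of bounded flat dimension under them -/

section ConcreteColimit

variable {A : Type u} [Ring A] {J : Type u} [SmallCategory J] {F : J ⥤ ModuleCat.{u} A}

/-- An elementwise description of the filtered colimits of modules. -/
structure IsElementwiseColimit (c : Cocone F) : Prop where
  exists_rep (x : c.pt) : ∃ (j : J) (y : F.obj j), c.ι.app j y = x
  exists_map_eq_zero {j : J} (y : F.obj j) (hy : c.ι.app j y = 0) :
    ∃ (k : J) (f : j ⟶ k), F.map f y = 0

theorem cocone_naturality_apply (c : Cocone F) {j k : J} (f : j ⟶ k) (y : F.obj j) :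
    c.ι.app k (F.map f y) = c.ι.app j y := by
  rw [← c.w f]; rfl

theorem IsElementwiseColimit.of_isColimit [IsFiltered J] {c : Cocone F} (hc : IsColimit c) :
    IsElementwiseColimit c where
  exists_rep x := Concrete.isColimit_exists_rep F hc x
  exists_map_eq_zero {j} y hy := by
    obtain ⟨k, f, h⟩ := (IsColimit.eq_iff' hc y 0).1 (by rw [hy, map_zero])
    exact ⟨k, f, by rw [h, map_zero]⟩

theorem IsElementwiseColimit.nonempty_isColimit [IsFiltered J] {c : Cocone F}
    (hc : IsElementwiseColimit c) : Nonempty (IsColimit c) := by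
  have hd := IsElementwiseColimit.of_isColimit (colimit.isColimit F)
  have hdesc (j : J) (y : F.obj j) :
      (colimit.isColimit F).desc c ((colimit.cocone F).ι.app j y) = c.ι.app j y := by
    rw [← (colimit.isColimit F).fac c j]; rfl
  have : IsIso ((colimit.isColimit F).desc c) := by
    rw [ConcreteCategory.isIso_iff_bijective]
    constructor
    · rw [injective_iff_map_eq_zero]
      intro x hx
      obtain ⟨j, y, rfl⟩ := hd.exists_rep x
      rw [hdesc] at hx
      obtain ⟨k, f, hf⟩ := hc.exists_map_eq_zero y hx
      rw [← cocone_naturality_apply _ f, hf, map_zero]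
    · intro x
      obtain ⟨j, y, rfl⟩ := hc.exists_rep x
      exact ⟨_, hdesc j y⟩
  exact ⟨IsColimit.ofPointIso (colimit.isColimit F)⟩

theorem hasCardinalLT_aleph_one (K : Type*) [Countable K] :
    HasCardinalLT K (ℵ₁ : Cardinal.{u}) := by
  rw [HasCardinalLT, Cardinal.lift_aleph, Ordinal.lift_one]
  exact (Cardinal.lift_le_aleph0.2 Cardinal.mk_le_aleph0).trans_lt Cardinal.aleph0_lt_aleph_one

namespace IsElementwiseColimit

variable [IsCardinalFiltered J (ℵ₁ : Cardinal.{u})] {c : Cocone F} (hc : IsElementwiseColimit c)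
  {X : Type*} [Countable X]
include hc

theorem exists_rep_family (x : X → c.pt) : ∃ (j : J) (y : X → F.obj j),
    ∀ i, c.ι.app j (y i) = x i := by
  choose j y hy using fun i ↦ hc.exists_rep (x i)
  have hX := hasCardinalLT_aleph_one.{u} X
  exact ⟨IsCardinalFiltered.max j hX, fun i ↦ F.map (IsCardinalFiltered.toMax j hX i) (y i),
    fun i ↦ by rw [cocone_naturality_apply, hy]⟩

theorem exists_map_eq_zero_family {j : J} (y : X → F.obj j) (hy : ∀ i, c.ι.app j (y i) = 0) :
    ∃ (k : J) (f : j ⟶ k), ∀ i, F.map f (y i) = 0 := by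
  choose k f hf using fun i ↦ hc.exists_map_eq_zero (y i) (hy i)
  obtain ⟨l, a, b, h⟩ := IsCardinalFiltered.wideSpan f (hasCardinalLT_aleph_one.{u} X)
  exact ⟨l, b, fun i ↦ by rw [← h i, F.map_comp, ModuleCat.comp_apply, hf, map_zero]⟩

/-- The criterion involves finitely many elements and one relation: the elements lift to one stage,
the relation holds at a later one, and the factorization found there is pushed to the colimit. -/
theorem isLazardFlat (hF : ∀ j, IsLazardFlat A (F.obj j)) : IsLazardFlat A c.pt := by
  refine IsLazardFlat.of_finite fun X _ φ l hl ↦ ?_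
  obtain ⟨j, y, hy⟩ := hc.exists_rep_family fun i : X ↦ φ (Finsupp.single i 1)
  have hφ : (c.ι.app j).hom ∘ₗ Finsupp.linearCombination A y = φ := by
    ext i
    simpa using hy i
  obtain ⟨k, f, hf⟩ := hc.exists_map_eq_zero (Finsupp.linearCombination A y l)
    ((LinearMap.congr_fun hφ l).trans hl)
  obtain ⟨κ, α, β, h₁, h₂⟩ := hF k X ((F.map f).hom ∘ₗ Finsupp.linearCombination A y) l hf
  refine ⟨κ, α, (c.ι.app k).hom ∘ₗ β, ?_, h₂⟩
  rw [LinearMap.comp_assoc, h₁, ← hφ, ← LinearMap.comp_assoc, ← ModuleCat.hom_comp, c.w]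

end IsElementwiseColimit

/-- The first syzygy of a module for its canonical free presentation, as a functor. -/
noncomputable def syzygyFunctor (A : Type u) [Ring A] : ModuleCat.{u} A ⥤ ModuleCat.{u} A where
  obj M := ModuleCat.of A (LinearMap.ker (Finsupp.linearCombination A (id : M → M)))
  map {M N} f := ModuleCat.ofHom ((Finsupp.lmapDomain A A f).restrict fun v hv ↦ by
    have : Finsupp.linearCombination A (id : N → N) ∘ₗ Finsupp.lmapDomain A A f =
        f.hom ∘ₗ Finsupp.linearCombination A (id : M → M) := by ext; simp
    rw [LinearMap.mem_ker] at hv ⊢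
    rw [← LinearMap.comp_apply, this, LinearMap.comp_apply, hv, map_zero])
  map_id M := by
    refine ModuleCat.hom_ext (LinearMap.ext fun v ↦ Subtype.ext ?_)
    exact Finsupp.mapDomain_id
  map_comp f g := by
    refine ModuleCat.hom_ext (LinearMap.ext fun v ↦ Subtype.ext ?_)
    exact Finsupp.mapDomain_comp (v := v.1) (f := f.hom) (g := g.hom)

theorem HasFlatResolution.syzygyFunctor_obj {m : ℕ} {M : ModuleCat.{u} A}
    (h : HasFlatResolution (m + 1) M) : HasFlatResolution m ((syzygyFunctor A).obj M) :=
  h.syzygy (.finsupp M) (i := (LinearMap.ker _).subtype) Subtype.val_injective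
    (LinearMap.exact_subtype_ker_map (Finsupp.linearCombination A (id : M → M)))
    (Finsupp.linearCombination_id_surjective _ _)

theorem HasFlatResolution.of_syzygyFunctor_obj {m : ℕ} {M : ModuleCat.{u} A}
    (h : HasFlatResolution m ((syzygyFunctor A).obj M)) : HasFlatResolution (m + 1) M :=
  ⟨_, ModuleCat.of A (M →₀ A), (LinearMap.ker _).subtype, _, Subtype.val_injective,
    LinearMap.exact_subtype_ker_map (Finsupp.linearCombination A (id : M → M)),
    Finsupp.linearCombination_id_surjective _ _, IsLazardFlat.finsupp _, h⟩

/-- A formal combination involves finitely many elements of the colimit, so it lifts to a stage, and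
lies in the kernel of evaluation at a later one. -/
theorem IsElementwiseColimit.mapCocone_syzygyFunctor [IsCardinalFiltered J (ℵ₁ : Cardinal.{u})]
    {c : Cocone F} (hc : IsElementwiseColimit c) :
    IsElementwiseColimit ((syzygyFunctor A).mapCocone c) where
  exists_rep := by
    rintro ⟨v, hv⟩
    obtain ⟨j, y, hy⟩ := hc.exists_rep_family fun i : v.support ↦ i.1
    let w : F.obj j →₀ A := ∑ i : v.support, Finsupp.single (y i) (v i.1)
    have hw : Finsupp.mapDomain (c.ι.app j) w = v := by
      rw [← Finsupp.lmapDomain_apply A A, map_sum]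
      simp only [Finsupp.lmapDomain_apply, Finsupp.mapDomain_single, hy]
      rw [Finset.sum_coe_sort v.support fun i ↦ Finsupp.single i (v i)]
      exact Finsupp.sum_single v
    obtain ⟨k, f, hf⟩ := hc.exists_map_eq_zero (Finsupp.linearCombination A id w) (by
      rw [LinearMap.mem_ker, ← hw] at hv
      rw [← hv, Finsupp.linearCombination_mapDomain, Finsupp.linearCombination_apply,
        Finsupp.linearCombination_apply, map_finsuppSum]
      simp)
    refine ⟨k, ⟨Finsupp.mapDomain (F.map f) w, ?_⟩, Subtype.ext ?_⟩
    · rw [LinearMap.mem_ker, Finsupp.linearCombination_mapDomain, ← hf,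
        Finsupp.linearCombination_apply, Finsupp.linearCombination_apply, map_finsuppSum]
      simp
    · refine Eq.trans ?_ hw
      change Finsupp.mapDomain (c.ι.app k) (Finsupp.mapDomain (F.map f) w) = _
      rw [← Finsupp.mapDomain_comp]
      congr 1
      ext x
      exact cocone_naturality_apply c f x
  exists_map_eq_zero := by
    rintro j ⟨v, hv⟩ h
    replace h : Finsupp.mapDomain (c.ι.app j) v = 0 := congrArg Subtype.val h
    obtain ⟨k, f, hf⟩ := hc.exists_map_eq_zero_family
      -- Identifying at stage `k` all support elements that agree in the colimit makes the colimit
      -- map injective on their images, so the formal sum already vanishes at `k`.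
      (X := {p : v.support × v.support // c.ι.app j p.1.1 = c.ι.app j p.2.1})
      (fun p ↦ p.1.1.1 - p.1.2.1) fun p ↦ by rw [map_sub, p.2, sub_self]
    refine ⟨k, f, Subtype.ext ?_⟩
    change Finsupp.mapDomain (F.map f) v = 0
    classical
    refine Finsupp.mapDomain_injOn (F.map f '' v.support) (f := c.ι.app k) ?_ ?_ ?_ ?_
    · rintro _ ⟨x, hx, rfl⟩ _ ⟨y, hy, rfl⟩ hxy
      rw [cocone_naturality_apply, cocone_naturality_apply] at hxy
      have := hf ⟨⟨⟨x, hx⟩, ⟨y, hy⟩⟩, hxy⟩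
      rwa [map_sub, sub_eq_zero] at this
    · intro x hx
      simpa using Finsupp.mapDomain_support hx
    · simp
    · rw [← Finsupp.mapDomain_comp, Finsupp.mapDomain_zero, ← h]
      congr 1
      ext x
      exact cocone_naturality_apply c f x

theorem IsElementwiseColimit.hasFlatResolution [IsCardinalFiltered J (ℵ₁ : Cardinal.{u})]
    {c : Cocone F} (hc : IsElementwiseColimit c) {m : ℕ}
    (hF : ∀ j, HasFlatResolution m (F.obj j)) : HasFlatResolution m c.pt := by
  induction m generalizing F c with
  | zero => exact hc.isLazardFlat hF
  | succ m ih =>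
    exact .of_syzygyFunctor_obj (ih hc.mapCocone_syzygyFunctor fun j ↦ (hF j).syzygyFunctor_obj)

end ConcreteColimit

/-! ### Directed diagrams of subquotients -/

section Subquotient

variable {A : Type u} [Ring A] {J : Type u} [Preorder J] {P : Type u} [AddCommGroup P] [Module A P]

/-- The functor attached to two increasing families `U` and `V` of submodules, with values
the images of `U j` in the quotients by `U j ⊓ V j`. -/
def subquotientFunctor (U V : J →o Submodule A P) : J ⥤ ModuleCat.{u} A where
  obj j := ModuleCat.of A (U j ⧸ (V j).comap (U j).subtype)
  map {j k} f := ModuleCat.ofHom (Submodule.mapQ _ _ (Submodule.inclusion (U.monotone (leOfHom f)))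
    fun _ hx ↦ V.monotone (leOfHom f) hx)
  map_id j := by
    refine ModuleCat.hom_ext (LinearMap.ext fun x ↦ ?_)
    obtain ⟨x, rfl⟩ := Submodule.mkQ_surjective _ x
    rfl
  map_comp f g := by
    refine ModuleCat.hom_ext (LinearMap.ext fun x ↦ ?_)
    obtain ⟨x, rfl⟩ := Submodule.mkQ_surjective _ x
    rfl

/-- The projection from `U j` to the value at `j` of the functor of subquotients. -/
def subquotientMk (U V : J →o Submodule A P) (j : J) : U j →ₗ[A] (subquotientFunctor U V).obj j :=
  Submodule.mkQ _

theorem subquotientMk_surjective (U V : J →o Submodule A P) (j : J) :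
    Function.Surjective (subquotientMk U V j) :=
  Submodule.mkQ_surjective _

theorem subquotientMk_eq_zero_iff (U V : J →o Submodule A P) {j : J} (x : U j) :
    subquotientMk U V j x = 0 ↔ x.1 ∈ V j :=
  Submodule.Quotient.mk_eq_zero _

/-- The cocone on a functor of subquotients given by a map which vanishes on all `V j`. -/
def subquotientCocone (U V : J →o Submodule A P) {M : ModuleCat.{u} A} (ε : P →ₗ[A] M)
    (hV : ∀ j, V j ≤ LinearMap.ker ε) : Cocone (subquotientFunctor U V) where
  pt := M
  ι :=
    { app j := ModuleCat.ofHom (Submodule.liftQ _ (ε ∘ₗ (U j).subtype) fun _ hx ↦ hV j hx)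
      naturality j k f := by
        refine ModuleCat.hom_ext (LinearMap.ext fun x ↦ ?_)
        obtain ⟨x, rfl⟩ := Submodule.mkQ_surjective _ x
        rfl }

theorem isElementwiseColimit_subquotientCocone (U V : J →o Submodule A P) {M : ModuleCat.{u} A}
    (ε : P →ₗ[A] M) (hV : ∀ j, V j ≤ LinearMap.ker ε) (hε : Function.Surjective ε)
    (h₁ : ∀ x, ∃ j, x ∈ U j) (h₂ : ∀ j, ∀ x ∈ U j, ε x = 0 → ∃ k, j ≤ k ∧ x ∈ V k) :
    IsElementwiseColimit (subquotientCocone U V ε hV) where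
  exists_rep x := by
    obtain ⟨y, rfl⟩ := hε x
    obtain ⟨j, hj⟩ := h₁ y
    exact ⟨j, Submodule.Quotient.mk ⟨y, hj⟩, rfl⟩
  exists_map_eq_zero {j} y hy := by
    obtain ⟨⟨x, hx⟩, rfl⟩ := Submodule.Quotient.mk_surjective _ y
    obtain ⟨k, hk, hxk⟩ := h₂ j x hx hy
    exact ⟨k, homOfLE hk, (Submodule.Quotient.mk_eq_zero _).2 hxk⟩

theorem isCardinalFiltered_of_countable_bddAbove {J : Type u} [Preorder J]
    (h : ∀ S : Set J, S.Countable → BddAbove S) : IsCardinalFiltered J (ℵ₁ : Cardinal.{u}) := by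
  refine isCardinalFiltered_preorder _ _ fun K s hK ↦ ?_
  have : Countable K := by
    rwa [← Cardinal.mk_le_aleph0_iff, ← Order.lt_succ_iff, Cardinal.succ_aleph0]
  obtain ⟨j, hj⟩ := h (Set.range s) (Set.countable_range s)
  exact ⟨j, fun k ↦ hj ⟨k, rfl⟩⟩

end Subquotient

/-! ### Countable presentability as countably many generators and relations -/

section CountablyGenerated

variable {A : Type u} [Ring A] {M N : Type u} [AddCommGroup M] [Module A M]
  [AddCommGroup N] [Module A N]

/-- A submodule is countably generated if it is spanned by a countable set. -/
def Submodule.IsCountablyGenerated (K : Submodule A M) : Prop :=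
  ∃ s : Set M, s.Countable ∧ Submodule.span A s = K

namespace Submodule.IsCountablyGenerated

theorem of_fg {K : Submodule A M} (h : K.FG) : K.IsCountablyGenerated := by
  obtain ⟨s, hs⟩ := h
  exact ⟨s, s.countable_toSet, hs⟩

theorem iSup {ι : Type*} [Countable ι] {K : ι → Submodule A M}
    (h : ∀ i, (K i).IsCountablyGenerated) : (⨆ i, K i).IsCountablyGenerated := by
  choose s hs h using h
  exact ⟨⋃ i, s i, Set.countable_iUnion hs, by simp only [Submodule.span_iUnion, h]⟩

theorem sup {K L : Submodule A M} (hK : K.IsCountablyGenerated) (hL : L.IsCountablyGenerated) :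
    (K ⊔ L).IsCountablyGenerated := by
  obtain ⟨s, hs, rfl⟩ := hK
  obtain ⟨t, ht, rfl⟩ := hL
  exact ⟨s ∪ t, hs.union ht, Submodule.span_union s t⟩

theorem map {K : Submodule A M} (h : K.IsCountablyGenerated) (f : M →ₗ[A] N) :
    (K.map f).IsCountablyGenerated := by
  obtain ⟨s, hs, rfl⟩ := h
  exact ⟨f '' s, hs.image f, Submodule.span_image f⟩

theorem range_finsupp {X : Type*} [Countable X] (f : (X →₀ A) →ₗ[A] M) :
    (LinearMap.range f).IsCountablyGenerated := by
  refine ⟨Set.range fun i ↦ f (Finsupp.single i 1), Set.countable_range _, ?_⟩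
  rw [← Finsupp.range_linearCombination]
  congr 1
  ext; simp

end Submodule.IsCountablyGenerated

/-- A map out of `M` is a countable family of elements subject to countably many equations, and both
are settled at a single stage of an `ℵ₁`-directed colimit. -/
theorem isCardinalPresentable_of_isCountablyGenerated_ker {M : ModuleCat.{u} A} {X : Type u}
    [Countable X] (p : (X →₀ A) →ₗ[A] M) (hp : Function.Surjective p)
    (h : (LinearMap.ker p).IsCountablyGenerated) :
    isCardinalPresentable (ModuleCat.{u} A) (ℵ₁ : Cardinal.{u}) M where
  preservesColimitOfShape J _ _ := ⟨fun {F} ↦ ⟨fun {c} hc ↦ ⟨by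
    have := isFiltered_of_isCardinalFiltered J (ℵ₁ : Cardinal.{u})
    have hc := IsElementwiseColimit.of_isColimit hc
    refine Types.FilteredColimit.isColimitOf' _ _ (fun f ↦ ?_) (fun j f₁ f₂ hf ↦ ?_)
    · change M ⟶ c.pt at f
      obtain ⟨s, hs, hsp⟩ := h
      have := hs.to_subtype
      obtain ⟨j, y, hy⟩ := hc.exists_rep_family fun i ↦ f (p (Finsupp.single i 1))
      have hφ : (c.ι.app j).hom ∘ₗ Finsupp.linearCombination A y = f.hom ∘ₗ p := by
        ext i
        simpa using hy i
      obtain ⟨k, g, hg⟩ := hc.exists_map_eq_zero_family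
        (fun v : s ↦ Finsupp.linearCombination A y v.1) fun v ↦ by
          refine (LinearMap.congr_fun hφ v.1).trans ?_
          have : v.1 ∈ LinearMap.ker p := hsp ▸ Submodule.subset_span v.2
          rw [LinearMap.mem_ker] at this
          rw [LinearMap.comp_apply, this, map_zero]
      have hk : LinearMap.ker p ≤ LinearMap.ker ((F.map g).hom ∘ₗ Finsupp.linearCombination A y) := by
        rw [← hsp, Submodule.span_le]
        exact fun v hv ↦ hg ⟨v, hv⟩
      let e := p.quotKerEquivOfSurjective hp
      refine ⟨k, ModuleCat.ofHom ((LinearMap.ker p).liftQ _ hk ∘ₗ e.symm.toLinearMap), ?_⟩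
      refine ModuleCat.hom_ext (LinearMap.ext fun x ↦ ?_)
      obtain ⟨x, rfl⟩ := hp x
      have he : e.symm (p x) = Submodule.Quotient.mk x := e.symm_apply_eq.2 rfl
      change f (p x) = c.ι.app k ((LinearMap.ker p).liftQ _ hk (e.symm (p x)))
      rw [he]
      change _ = c.ι.app k (F.map g (Finsupp.linearCombination A y x))
      rw [cocone_naturality_apply]
      exact (LinearMap.congr_fun hφ x).symm
    · change M ⟶ F.obj j at f₁ f₂
      change f₁ ≫ c.ι.app j = f₂ ≫ c.ι.app j at hf
      obtain ⟨k, g, hg⟩ := hc.exists_map_eq_zero_family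
        (fun i ↦ f₁ (p (Finsupp.single i 1)) - f₂ (p (Finsupp.single i 1))) fun i ↦ by
          rw [map_sub, sub_eq_zero]
          exact ConcreteCategory.congr_hom hf _
      refine ⟨k, g, ?_⟩
      change f₁ ≫ F.map g = f₂ ≫ F.map g
      have : (f₁ ≫ F.map g).hom ∘ₗ p = (f₂ ≫ F.map g).hom ∘ₗ p := by
        ext i
        simpa [sub_eq_zero] using hg i
      refine ModuleCat.hom_ext (LinearMap.ext fun x ↦ ?_)
      obtain ⟨x, rfl⟩ := hp x
      exact LinearMap.congr_fun this x⟩⟩⟩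

/-- `M` is the `ℵ₁`-directed colimit of the quotients of the free module by the countably generated
submodules `K` of `ker p`, so its identity factors through one of them. Lifting the section to an
endomorphism `θ` of the free module gives `ker p = K + im (1 - θ)`, where both summands are
countably generated. -/
theorem isCountablyGenerated_ker_of_isCardinalPresentable {M : ModuleCat.{u} A} {X : Type u}
    [Countable X] (hM : isCardinalPresentable (ModuleCat.{u} A) (ℵ₁ : Cardinal.{u}) M)
    (p : (X →₀ A) →ₗ[A] M) (hp : Function.Surjective p) :
    (LinearMap.ker p).IsCountablyGenerated := by
  let J := {K : Submodule A (X →₀ A) // K ≤ LinearMap.ker p ∧ K.IsCountablyGenerated}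
  have hJ (S : Set J) (hS : S.Countable) : BddAbove S := by
    have := hS.to_subtype
    exact ⟨⟨⨆ K : S, K.1.1, iSup_le fun K ↦ K.1.2.1, .iSup fun K ↦ K.1.2.2⟩,
      fun K hK ↦ le_iSup (fun K : S ↦ K.1.1) ⟨K, hK⟩⟩
  have := isCardinalFiltered_of_countable_bddAbove hJ
  have := isFiltered_of_isCardinalFiltered J (ℵ₁ : Cardinal.{u})
  let U : J →o Submodule A (X →₀ A) := ⟨fun _ ↦ ⊤, fun _ _ _ ↦ le_rfl⟩
  let V : J →o Submodule A (X →₀ A) := ⟨fun K ↦ K.1, fun _ _ h ↦ h⟩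
  obtain ⟨hc⟩ := (isElementwiseColimit_subquotientCocone U V p (fun K ↦ K.2.1) hp
    (fun x ↦ ⟨⟨⊥, bot_le, .of_fg Submodule.fg_bot⟩, trivial⟩) fun K x _ hx ↦
      ⟨⟨K.1 ⊔ Submodule.span A {x}, sup_le K.2.1 (by simpa using hx),
        K.2.2.sup (.of_fg (Submodule.fg_span_singleton x))⟩, le_sup_left (a := K.1),
        Submodule.mem_sup_right (Submodule.mem_span_singleton_self x)⟩).nonempty_isColimit
  have : IsCardinalPresentable M (ℵ₁ : Cardinal.{u}) := hM
  have := essentiallySmallSelf.{u} J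
  obtain ⟨K, s, hs⟩ := IsCardinalPresentable.exists_hom_of_isColimit (ℵ₁ : Cardinal.{u}) hc (𝟙 M)
  let q : (X →₀ A) →ₗ[A] (subquotientFunctor U V).obj K :=
    subquotientMk U V K ∘ₗ LinearMap.id.codRestrict ⊤ fun _ ↦ trivial
  have hq : Function.Surjective q := fun x ↦ by
    obtain ⟨⟨x, hx⟩, rfl⟩ := subquotientMk_surjective U V K x
    exact ⟨x, rfl⟩
  have hqK (x) : q x = 0 ↔ x ∈ K.1 := subquotientMk_eq_zero_iff U V _
  choose w hw using fun i ↦ hq (s.hom (p (Finsupp.single i 1)))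
  let θ : (X →₀ A) →ₗ[A] (X →₀ A) := Finsupp.linearCombination A w
  have hθ : q ∘ₗ θ = s.hom ∘ₗ p := by
    ext i
    simpa [θ] using hw i
  have hθ' (x) : q (θ x) = s.hom (p x) := LinearMap.congr_fun hθ x
  have hpq (x) : (subquotientCocone U V p fun K ↦ K.2.1).ι.app K (q x) = p x := rfl
  have : LinearMap.ker p = K.1 ⊔ LinearMap.range (LinearMap.id - θ) := by
    apply le_antisymm
    · intro x hx
      rw [← add_sub_cancel (θ x) x]
      refine add_mem (Submodule.mem_sup_left ?_) (Submodule.mem_sup_right ⟨x, rfl⟩)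
      rw [← hqK, hθ', LinearMap.mem_ker.1 hx, map_zero]
    · refine sup_le K.2.1 ?_
      rintro _ ⟨x, rfl⟩
      have hx : p (θ x) = p x := (hpq (θ x)).symm.trans
        ((congrArg _ (hθ' x)).trans (ConcreteCategory.congr_hom hs (p x)))
      simp [hx]
  rw [this]
  exact K.2.2.sup (.range_finsupp _)

end CountablyGenerated

/-! ### Countably coherent rings -/

section CountablyCoherent

variable {A : Type u} [Ring A]

variable (A) in
/-- A ring is countably coherent if the relations between finitely many of its elements form
a countably generated module. -/
def IsCountablyCoherent : Prop :=
  ∀ (X : Type u) [Finite X] (f : (X →₀ A) →ₗ[A] A), (LinearMap.ker f).IsCountablyGenerated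

namespace IsCountablyCoherent

variable (hA : IsCountablyCoherent A) {P : Type u} [AddCommGroup P] [Module A P]
include hA

/-- An element of the span involves a finite set of generators, and a countable generating set has
only countably many finite subsets. Each contributes the image of a relation module that is
countably generated by hypothesis. -/
theorem inf_ker {K : Submodule A P} (hK : K.IsCountablyGenerated) (f : P →ₗ[A] A) :
    (K ⊓ LinearMap.ker f).IsCountablyGenerated := by
  obtain ⟨s, hs, rfl⟩ := hK
  have := hs.to_subtype
  let φ (t : Finset s) : (t →₀ A) →ₗ[A] P := Finsupp.linearCombination A fun i ↦ i.1.1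
  have h : Submodule.span A s ⊓ LinearMap.ker f =
      ⨆ t, (LinearMap.ker (f ∘ₗ φ t)).map (φ t) := by
    apply le_antisymm
    · rintro x ⟨hx, hfx⟩
      obtain ⟨l, rfl⟩ := (Finsupp.mem_span_iff_linearCombination A s x).1 hx
      let l' : l.support →₀ A := l.comapDomain Subtype.val Subtype.val_injective.injOn
      have hl : φ l.support l' = Finsupp.linearCombination A Subtype.val l := by
        have : Finsupp.mapDomain Subtype.val l' = l :=
          Finsupp.mapDomain_comapDomain _ Subtype.val_injective _ fun x hx ↦ ⟨⟨x, hx⟩, rfl⟩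
        conv_rhs => rw [← this, Finsupp.linearCombination_mapDomain]
        rfl
      refine Submodule.mem_iSup_of_mem l.support ⟨l', ?_, hl⟩
      change f (φ _ l') = 0
      rw [hl]
      exact hfx
    · refine iSup_le fun t ↦ ?_
      rintro _ ⟨l, hl, rfl⟩
      refine ⟨?_, hl⟩
      rw [SetLike.mem_coe, Finsupp.mem_span_iff_linearCombination]
      exact ⟨Finsupp.mapDomain Subtype.val l, Finsupp.linearCombination_mapDomain _ _ _⟩
  rw [h]
  exact .iSup fun t ↦ .map (hA _ _) _

/-- Finite generation of `K` leaves only finitely many coordinates of `d` to kill. They are killed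
one at a time; the intermediate submodules are merely countably generated, which is all that
`inf_ker` needs. -/
theorem inf_ker_finsupp {K : Submodule A P} (hK : K.FG) {Y : Type*} (d : P →ₗ[A] (Y →₀ A)) :
    (K ⊓ LinearMap.ker d).IsCountablyGenerated := by
  classical
  have h (B : Finset Y) :
      (K ⊓ ⨅ b ∈ B, LinearMap.ker (Finsupp.lapply b ∘ₗ d)).IsCountablyGenerated := by
    induction B using Finset.induction_on with
    | empty => simpa using .of_fg hK
    | insert b B _ ih =>
      rw [Finset.iInf_insert, inf_left_comm, inf_comm]
      exact hA.inf_ker ih _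
  obtain ⟨s, rfl⟩ := hK
  convert h (s.biUnion fun x ↦ (d x).support) using 1
  refine le_antisymm (le_inf inf_le_left (le_iInf₂ fun b _ ↦ inf_le_right.trans ?_)) ?_
  · intro x hx
    simp [LinearMap.mem_ker.1 hx]
  · rintro x ⟨hx, hdx⟩
    refine ⟨hx, Finsupp.ext fun b ↦ ?_⟩
    by_cases hb : b ∈ s.biUnion fun x ↦ (d x).support
    · simp only [SetLike.mem_coe, Submodule.mem_iInf] at hdx
      exact hdx b hb
    · have : Submodule.span A (s : Set P) ≤ LinearMap.ker (Finsupp.lapply b ∘ₗ d) := by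
        refine Submodule.span_le.2 fun y hy ↦ ?_
        simp only [Finset.mem_biUnion, not_exists, not_and, Finsupp.notMem_support_iff] at hb
        simpa using hb y hy
      exact this hx

end IsCountablyCoherent

theorem IsRightCountablyCoherent.isCountablyCoherent {R : Type u} [Ring R]
    (hR : IsRightCountablyCoherent R) : IsCountablyCoherent Rᵐᵒᵖ := by
  intro X _ f
  let e : R ≃ₗ[Rᵐᵒᵖ] Rᵐᵒᵖ :=
    { toFun := MulOpposite.op
      invFun := MulOpposite.unop
      map_add' := fun _ _ ↦ rfl
      map_smul' := fun _ _ ↦ rfl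
      left_inv := fun _ ↦ rfl
      right_inv := fun _ ↦ rfl }
  let g : (X →₀ Rᵐᵒᵖ) →ₗ[Rᵐᵒᵖ] R := e.symm.toLinearMap ∘ₗ f
  have hg : (LinearMap.range g).FG := by
    rw [LinearMap.range_eq_map]
    exact Submodule.FG.map _ Module.Finite.fg_top
  have h := isCountablyGenerated_ker_of_isCardinalPresentable (hR _ hg) g.rangeRestrict
    g.surjective_rangeRestrict
  rwa [LinearMap.ker_rangeRestrict, LinearEquiv.ker_comp] at h

end CountablyCoherent

/-! ### Countable closing-off -/

section Closure

/-- Add the required elements for all finite subsets, and iterate `ω` times. A finite subset of the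
union already lies in one stage, so the next stage serves it. -/
theorem exists_countable_closed_superset {S : Type*} (c : Finset S → Set S)
    (hc : ∀ T, (c T).Countable) {Y : Set S} (hY : Y.Countable) :
    ∃ Z : Set S, Y ⊆ Z ∧ Z.Countable ∧ ∀ T : Finset S, ↑T ⊆ Z → c T ⊆ Z := by
  let step (Y : Set S) : Set S := Y ∪ ⋃ T ∈ {T : Finset S | ↑T ⊆ Y}, c T
  have hstep {Y : Set S} (hY : Y.Countable) : (step Y).Countable := by
    refine hY.union (Set.Countable.biUnion ?_ fun T _ ↦ hc T)
    have := Set.countable_ofPred_finite_subset hY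
    exact (this.preimage Finset.coe_injective).mono fun T hT ↦ And.intro T.finite_toSet hT
  let Z (n : ℕ) : Set S := step^[n] Y
  have hZs (n) : Z (n + 1) = step (Z n) := Function.iterate_succ_apply' _ _ _
  have hZ : Monotone Z := monotone_nat_of_le_succ fun n ↦ by
    rw [hZs]; exact Set.subset_union_left
  have hZc (n) : (Z n).Countable := by
    induction n with
    | zero => exact hY
    | succ n ih => rw [hZs]; exact hstep ih
  refine ⟨⋃ n, Z n, Set.subset_iUnion Z 0, Set.countable_iUnion hZc, fun T hT ↦ ?_⟩
  obtain ⟨n, hn⟩ := hZ.directed_le.exists_mem_subset_of_finset_subset_biUnion hT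
  refine Set.Subset.trans ?_ (Set.subset_iUnion Z (n + 1))
  rw [hZs]
  exact Set.subset_union_of_subset_right (Set.subset_biUnion_of_mem (u := c) hn) _

end Closure

/-! ### Countable subcomplexes of a free resolution -/

section FreeResolution

variable {A : Type u} [Ring A]

/-- A resolution of a module by free modules, with chosen bases. -/
structure FreeResolution (M : ModuleCat.{u} A) where
  P : ℕ → ModuleCat.{u} A
  X : ℕ → Type u
  b (n : ℕ) : Module.Basis (X n) A (P n)
  d (n : ℕ) : P (n + 1) →ₗ[A] P n
  ε : P 0 →ₗ[A] M
  ε_surjective : Function.Surjective ε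
  range_d_zero : LinearMap.range (d 0) = LinearMap.ker ε
  range_d_succ (n : ℕ) : LinearMap.range (d (n + 1)) = LinearMap.ker (d n)

/-- The iterated syzygies of a module. -/
noncomputable def iteratedSyzygy (M : ModuleCat.{u} A) : ℕ → ModuleCat.{u} A
  | 0 => M
  | n + 1 => (syzygyFunctor A).obj (iteratedSyzygy M n)

theorem exists_freeResolution (M : ModuleCat.{u} A) : Nonempty (FreeResolution M) := by
  let X := iteratedSyzygy M
  let P (n : ℕ) : ModuleCat.{u} A := ModuleCat.of A (X n →₀ A)
  let π (n : ℕ) : P n →ₗ[A] X n := Finsupp.linearCombination A id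
  have hπ (n : ℕ) : Function.Surjective (π n) := Finsupp.linearCombination_id_surjective _ _
  let i (n : ℕ) : X (n + 1) →ₗ[A] P n := (LinearMap.ker (π n)).subtype
  have hi (n : ℕ) : LinearMap.range (i n) = LinearMap.ker (π n) := Submodule.range_subtype _
  have hi' (n : ℕ) : LinearMap.ker (i n) = ⊥ := Submodule.ker_subtype _
  have hr (n : ℕ) : LinearMap.range (i n ∘ₗ π (n + 1)) = LinearMap.ker (π n) := by
    rw [LinearMap.range_comp_of_range_eq_top _ (LinearMap.range_eq_top.2 (hπ (n + 1))), hi]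
  exact ⟨
    { P := P
      X := fun n ↦ X n
      b := fun n ↦ Finsupp.basisSingleOne
      d := fun n ↦ i n ∘ₗ π (n + 1)
      ε := π 0
      ε_surjective := hπ 0
      range_d_zero := hr 0
      range_d_succ := fun n ↦ by
        rw [hr, LinearMap.ker_comp_of_ker_eq_bot _ (hi' n)] }⟩

namespace FreeResolution

variable {M : ModuleCat.{u} A} (Q : FreeResolution M)

instance (n : ℕ) : Module.Projective A (Q.P n) := .of_basis (Q.b n)

/-- The cokernel of `d m` is the `m`th syzygy, with `m = 0` giving `M` itself; each step lowers the
flat dimension by one. -/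
theorem hasFlatResolution {m k : ℕ} (h : HasFlatResolution (k + m) M) :
    HasFlatResolution k (ModuleCat.of A (Q.P m ⧸ LinearMap.range (Q.d m))) := by
  induction m generalizing k with
  | zero =>
    exact h.of_linearEquiv ((Submodule.quotEquivOfEq _ _ Q.range_d_zero).trans
      (Q.ε.quotKerEquivOfSurjective Q.ε_surjective)).symm
  | succ m ih =>
    refine (ih (k := k + 1) (by rwa [add_assoc, add_comm 1])).syzygy (.of_basis (Q.b m))
      (i := Submodule.liftQ _ (Q.d m) (Q.range_d_succ m).le) (p := Submodule.mkQ _) ?_ ?_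
      (Submodule.mkQ_surjective _)
    · rw [← LinearMap.ker_eq_bot]
      exact Submodule.ker_liftQ_eq_bot _ _ _ (Q.range_d_succ m).ge
    · rw [LinearMap.exact_iff, Submodule.range_liftQ, Submodule.ker_mkQ]

theorem d_d (n : ℕ) (x) : Q.d n (Q.d (n + 1) x) = 0 := by
  rw [← LinearMap.mem_ker, ← range_d_succ]
  exact ⟨x, rfl⟩

/-- The elements of the `n`th term of a free resolution which are supported on a set of basis
elements of all the terms. -/
noncomputable def sub (n : ℕ) (Y : Set (Σ n, Q.X n)) : Submodule A (Q.P n) :=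
  Submodule.span A (Q.b n '' (Sigma.mk n ⁻¹' Y))

variable {Q}

theorem mem_sub_iff {n : ℕ} {Y : Set (Σ n, Q.X n)} {x : Q.P n} :
    x ∈ Q.sub n Y ↔ ∀ i ∈ ((Q.b n).repr x).support, ⟨n, i⟩ ∈ Y :=
  (Q.b n).mem_span_image

theorem sub_mono (n : ℕ) : Monotone (Q.sub n) := fun _ _ h ↦
  Submodule.span_mono (Set.image_mono (Set.preimage_mono h))

theorem fg_sub (n : ℕ) (T : Finset (Σ n, Q.X n)) : (Q.sub n T).FG :=
  Submodule.fg_span ((T.finite_toSet.preimage sigma_mk_injective.injOn).image _)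

theorem exists_mem_sub {n : ℕ} (x : Q.P n) :
    ∃ T : Finset (Σ n, Q.X n), x ∈ Q.sub n T ∧ ∀ Y, x ∈ Q.sub n Y → ↑T ⊆ Y := by
  classical
  refine ⟨((Q.b n).repr x).support.image (Sigma.mk n), mem_sub_iff.2 fun i hi ↦ ?_,
    fun Y hY z hz ↦ ?_⟩
  · exact Finset.mem_coe.2 (Finset.mem_image_of_mem _ hi)
  · obtain ⟨i, hi, rfl⟩ := Finset.mem_image.1 (Finset.mem_coe.1 hz)
    exact mem_sub_iff.1 hY i hi

theorem exists_finset_of_fg {n : ℕ} {K : Submodule A (Q.P n)} (hK : K.FG)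
    {Y : Set (Σ n, Q.X n)} (h : K ≤ Q.sub n Y) :
    ∃ T : Finset (Σ n, Q.X n), ↑T ⊆ Y ∧ K ≤ Q.sub n T := by
  classical
  obtain ⟨s, rfl⟩ := hK
  choose t ht ht' using exists_mem_sub (Q := Q) (n := n)
  refine ⟨s.biUnion t, ?_, Submodule.span_le.2 fun x hx ↦ sub_mono n ?_ (ht x)⟩
  · rw [Finset.coe_biUnion]
    exact Set.iUnion₂_subset fun x hx ↦ ht' x Y (h (Submodule.subset_span hx))
  · exact Finset.coe_subset.2 (Finset.subset_biUnion_of_mem t hx)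

theorem exists_countable_le_sub {n : ℕ} {K : Submodule A (Q.P n)}
    (hK : K.IsCountablyGenerated) :
    ∃ C : Set (Σ n, Q.X n), C.Countable ∧ ∀ Y, C ⊆ Y → K ≤ Q.sub n Y := by
  obtain ⟨s, hs, rfl⟩ := hK
  choose t ht _ using exists_mem_sub (Q := Q) (n := n)
  refine ⟨⋃ x ∈ s, ↑(t x), hs.biUnion fun x _ ↦ (t x).countable_toSet, fun Y hY ↦
    Submodule.span_le.2 fun x hx ↦ sub_mono n ?_ (ht x)⟩
  exact (Set.subset_biUnion_of_mem (u := fun x ↦ (t x : Set (Σ n, Q.X n))) hx).trans hY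

theorem exists_countable_le_map_sub {n : ℕ} {K : Submodule A (Q.P n)}
    (hK : K.IsCountablyGenerated) (h : K ≤ LinearMap.range (Q.d n)) :
    ∃ C : Set (Σ n, Q.X n), C.Countable ∧ ∀ Y, C ⊆ Y → K ≤ (Q.sub (n + 1) Y).map (Q.d n) := by
  obtain ⟨s, hs, rfl⟩ := hK
  rw [Submodule.span_le] at h
  choose w hw using fun x : s ↦ h x.2
  have := hs.to_subtype
  obtain ⟨C, hC, hCw⟩ := exists_countable_le_sub (Q := Q) (K := Submodule.span A (Set.range w))
    ⟨_, Set.countable_range w, rfl⟩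
  exact ⟨C, hC, fun Y hY ↦ Submodule.span_le.2 fun x hx ↦
    ⟨w ⟨x, hx⟩, hCw Y hY (Submodule.subset_span ⟨_, rfl⟩), hw ⟨x, hx⟩⟩⟩

/-- The presentations of the `m`th syzygy factor through free modules, as in Lazard's criterion,
using only the basis elements in `Y` and starting from those in `T`. -/
def FactorsThroughFree (m : ℕ) (T Y : Set (Σ n, Q.X n)) : Prop :=
  ∃ (κ : Type u) (α : Q.P m →ₗ[A] (κ →₀ A))
    (β : (κ →₀ A) →ₗ[A] Q.P m),
    LinearMap.range β ≤ Q.sub m Y ∧ (Q.sub (m + 1) T).map (Q.d m) ≤ LinearMap.ker α ∧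
    ∀ x ∈ Q.sub m T, x - β (α x) ∈ (Q.sub (m + 1) Y).map (Q.d m)

theorem exists_countable_factorsThroughFree {m : ℕ} (hM : HasFlatResolution m M)
    (T : Finset (Σ n, Q.X n)) :
    ∃ C : Set (Σ n, Q.X n), C.Countable ∧
      ∀ Y, C ⊆ Y → FactorsThroughFree m (T : Set (Σ n, Q.X n)) Y := by
  classical
  let F := Q.P m ⧸ LinearMap.range (Q.d m)
  let q : Q.P m →ₗ[A] F := Submodule.mkQ _
  have hq : Function.Surjective q := Submodule.mkQ_surjective _
  have hF : IsLazardFlat A F := Q.hasFlatResolution (k := 0) (by rwa [zero_add])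
  obtain ⟨L, hL⟩ := (fg_sub (Q := Q) (m + 1) T).map (Q.d m)
  -- The list `L` generates the boundaries coming from `T`, so killing its finitely many elements
  -- makes `α` kill all those boundaries.
  obtain ⟨κ, α', β, h₁, h₂⟩ := hF.exists_factor (q ∘ₗ (Q.b m).repr.symm.toLinearMap)
    (L.image (Q.b m).repr) fun l hl ↦ by
      obtain ⟨l, hl', rfl⟩ := Finset.mem_image.1 hl
      have : l ∈ (Q.sub (m + 1) T).map (Q.d m) := hL ▸ Submodule.subset_span hl'
      obtain ⟨x, -, rfl⟩ := this
      have : q (Q.d m x) = 0 := (Submodule.Quotient.mk_eq_zero _).2 ⟨x, rfl⟩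
      simpa using this
  let α : Q.P m →ₗ[A] (κ →₀ A) := α' ∘ₗ (Q.b m).repr.toLinearMap
  replace h₁ (x) : β (α x) = q x :=
    (LinearMap.congr_fun h₁ ((Q.b m).repr x)).trans (by simp)
  replace h₂ (l) (hl : l ∈ L) : α l = 0 := h₂ _ (Finset.mem_image_of_mem _ hl)
  obtain ⟨β', hβ⟩ := Module.projective_lifting_property _ β hq
  replace hβ (x) : q (β' x) = β x := LinearMap.congr_fun hβ x
  obtain ⟨s, hs⟩ := (fg_sub (Q := Q) m T).map α
  let B : Finset κ := s.biUnion Finsupp.support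
  have hB : (Q.sub m T).map α ≤ Finsupp.supported A A (B : Set κ) := by
    rw [← hs, Submodule.span_le]
    intro x hx
    exact Finset.coe_subset.2 (Finset.subset_biUnion_of_mem Finsupp.support hx)
  have hBfg : (Finsupp.supported A A (B : Set κ)).FG := by
    rw [Finsupp.supported_eq_span_single]
    exact Submodule.fg_span (B.finite_toSet.image _)
  -- As `κ` may be uncountable, the range of `β'` can be too large. Projecting to the finitely many
  -- coordinates met by the image of `Q.sub m T` makes the range finitely generated, and changes
  -- nothing on elements of `Q.sub m T`.
  let ρ : (κ →₀ A) →ₗ[A] (κ →₀ A) :=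
    (Finsupp.supported A A (B : Set κ)).subtype ∘ₗ Finsupp.restrictDom A A (B : Set κ)
  have hρ (x) (hx : x ∈ Finsupp.supported A A (B : Set κ)) : ρ x = x :=
    Finsupp.filter_eq_self_iff _ _ |>.2 fun i hi ↦ hx (Finsupp.mem_support_iff.2 hi)
  obtain ⟨C₁, hC₁, h₃⟩ := exists_countable_le_sub (Q := Q) (K := LinearMap.range (β' ∘ₗ ρ)) (by
    refine .of_fg ?_
    have : LinearMap.range (β' ∘ₗ ρ) = (Finsupp.supported A A (B : Set κ)).map β' := by
      rw [LinearMap.range_comp, LinearMap.range_comp, Finsupp.range_restrictDom, Submodule.map_top,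
        Submodule.range_subtype]
    rw [this]
    exact hBfg.map _)
  obtain ⟨C₂, hC₂, h₄⟩ := exists_countable_le_map_sub (Q := Q)
    (K := (Q.sub m T).map (LinearMap.id - β' ∘ₗ ρ ∘ₗ α)) (.of_fg ((fg_sub m T).map _)) (by
      rintro _ ⟨x, hx, rfl⟩
      rw [← Submodule.ker_mkQ (LinearMap.range (Q.d m))]
      change q _ = 0
      simp [hρ _ (hB ⟨x, hx, rfl⟩), hβ, h₁])
  refine ⟨C₁ ∪ C₂, hC₁.union hC₂, fun Y hY ↦ ⟨κ, α, β' ∘ₗ ρ,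
    h₃ Y (Set.subset_union_left.trans hY), ?_, fun x hx ↦
    h₄ Y (Set.subset_union_right.trans hY) ⟨x, hx, rfl⟩⟩⟩
  rw [← hL, Submodule.span_le]
  exact h₂

/-- The sets of basis elements of the canonical resolution such that the subcomplex they span is
exact and has a flat `m`th syzygy. -/
structure IsGood (m : ℕ) (Y : Set (Σ n, Q.X n)) : Prop where
  countable : Y.Countable
  map_le (n : ℕ) : (Q.sub (n + 1) Y).map (Q.d n) ≤ Q.sub n Y
  inf_ker_le (n : ℕ) : Q.sub (n + 1) Y ⊓ LinearMap.ker (Q.d n) ≤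
    (Q.sub (n + 2) Y).map (Q.d (n + 1))
  factorsThroughFree (T : Finset (Σ n, Q.X n)) (hT : ↑T ⊆ Y) :
    FactorsThroughFree m (T : Set (Σ n, Q.X n)) Y

/-- The sets `C₁`, `C₂`, `C₃` hold what a finite `T` requires: supports of its boundaries, preimages
of its cycles, and a Lazard factorization. Coherence makes `C₂` countable, and closing off under all
three gives a good set. -/
theorem exists_isGood (hA : IsCountablyCoherent A) {m : ℕ} (hM : HasFlatResolution m M)
    {Y : Set (Σ n, Q.X n)} (hY : Y.Countable) : ∃ Z, Y ⊆ Z ∧ IsGood m Z := by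
  choose C₁ hC₁ h₁ using fun n (T : Finset (Σ n, Q.X n)) ↦
    exists_countable_le_sub (Q := Q) (.of_fg ((fg_sub (n + 1) T).map (Q.d n)))
  choose C₂ hC₂ h₂ using fun n (T : Finset (Σ n, Q.X n)) ↦
    exists_countable_le_map_sub (Q := Q) (K := Q.sub (n + 1) T ⊓ LinearMap.ker (Q.d n)) (by
      have := hA.inf_ker_finsupp (fg_sub (n + 1) T) ((Q.b n).repr.toLinearMap ∘ₗ Q.d n)
      rwa [LinearEquiv.ker_comp] at this) (inf_le_right.trans (Q.range_d_succ n).ge)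
  choose C₃ hC₃ h₃ using exists_countable_factorsThroughFree hM
  obtain ⟨Z, hYZ, hZ, hcZ⟩ := exists_countable_closed_superset
    (fun T ↦ (⋃ n, C₁ n T) ∪ (⋃ n, C₂ n T) ∪ C₃ T)
    (fun T ↦ ((Set.countable_iUnion fun n ↦ hC₁ n T).union
      (Set.countable_iUnion fun n ↦ hC₂ n T)).union (hC₃ T)) hY
  refine ⟨Z, hYZ, hZ, fun n ↦ ?_, fun n ↦ ?_, fun T hT ↦ ?_⟩
  · rintro _ ⟨x, hx, rfl⟩
    obtain ⟨T, hxT, hT⟩ := exists_mem_sub x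
    exact h₁ n T Z ((Set.subset_iUnion (fun n ↦ C₁ n T) n).trans
      (Set.subset_union_left.trans (Set.subset_union_left.trans (hcZ T (hT Z hx))))) ⟨x, hxT, rfl⟩
  · rintro x ⟨hx, hdx⟩
    obtain ⟨T, hxT, hT⟩ := exists_mem_sub x
    exact h₂ n T Z ((Set.subset_iUnion (fun n ↦ C₂ n T) n).trans
      (Set.subset_union_right.trans (Set.subset_union_left.trans (hcZ T (hT Z hx))))) ⟨hxT, hdx⟩
  · exact h₃ T Z (Set.subset_union_right.trans (hcZ T hT))

variable (Q) in
/-- The `n`th syzygy of the subcomplex of the canonical resolution attached to a set of basis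
elements. -/
abbrev Syzygy (n : ℕ) (Y : Set (Σ n, Q.X n)) : Type u :=
  Q.sub n Y ⧸ ((Q.sub (n + 1) Y).map (Q.d n)).comap (Q.sub n Y).subtype

/-- The basis of the elements supported on a set of basis elements. -/
noncomputable def subBasis (n : ℕ) (Y : Set (Σ n, Q.X n)) :
    Module.Basis (Sigma.mk n ⁻¹' Y : Set (Q.X n)) A (Q.sub n Y) :=
  (Module.Basis.span ((Q.b n).linearIndependent.comp _ Subtype.val_injective)).map
    (LinearEquiv.ofEq _ _ (by rw [sub, Set.image_eq_range]; rfl))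

namespace IsGood

variable {m : ℕ} {Y : Set (Σ n, Q.X n)} (hY : IsGood m Y)
include hY

/-- A finite Lazard problem lifts to `Q.sub m Y`, where its relation becomes the boundary of some
`w`. The supports of the lifted generators and of `w` form a finite subset of `Y`, and the
factorization attached to it solves the problem. -/
theorem isLazardFlat : IsLazardFlat A (Q.Syzygy m Y) := by
  classical
  refine IsLazardFlat.of_finite fun X _ φ l hl ↦ ?_
  let q : Q.sub m Y →ₗ[A] Q.Syzygy m Y := Submodule.mkQ _
  have hq : Function.Surjective q := Submodule.mkQ_surjective _
  obtain ⟨ψ, hψ⟩ := Module.projective_lifting_property q φ hq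
  have hψ' (x) : q (ψ x) = φ x := LinearMap.congr_fun hψ x
  let χ : (X →₀ A) →ₗ[A] Q.P m := (Q.sub m Y).subtype ∘ₗ ψ
  obtain ⟨w, hwY, hw⟩ : χ l ∈ (Q.sub (m + 1) Y).map (Q.d m) :=
    by
    have h₀ : q (ψ l) = 0 := (hψ' l).trans hl
    rw [← LinearMap.mem_ker, Submodule.ker_mkQ] at h₀
    exact h₀
  obtain ⟨T₁, hT₁Y, hT₁⟩ := exists_finset_of_fg (K := LinearMap.range χ) (Y := Y)
    (by rw [LinearMap.range_eq_map]; exact Module.Finite.fg_top.map _)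
    (by rintro _ ⟨x, rfl⟩; exact (ψ x).2)
  obtain ⟨T₂, hwT₂, hT₂⟩ := exists_mem_sub w
  obtain ⟨κ, α, β, h₁, h₂, h₃⟩ := hY.factorsThroughFree (T₁ ∪ T₂) (by
    rw [Finset.coe_union]; exact Set.union_subset hT₁Y (hT₂ Y hwY))
  refine ⟨κ, α ∘ₗ χ, q ∘ₗ β.codRestrict _ fun x ↦ h₁ ⟨x, rfl⟩, LinearMap.ext fun x ↦ ?_, ?_⟩
  · rw [← hψ' x, eq_comm, ← sub_eq_zero]
    change q _ - q _ = 0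
    rw [← map_sub]
    exact (Submodule.Quotient.mk_eq_zero _).2 (h₃ (χ x)
      (sub_mono m (by simp) (hT₁ ⟨x, rfl⟩)))
  · rw [LinearMap.comp_apply, ← hw, ← LinearMap.mem_ker]
    exact h₂ ⟨w, sub_mono _ (by simp) hwT₂, rfl⟩

/-- The differential of the subcomplex attached to a good set. -/
noncomputable def dRestrict (n : ℕ) : Q.sub (n + 1) Y →ₗ[A] Q.sub n Y :=
  (Q.d n).restrict fun x hx ↦ hY.map_le n ⟨x, hx, rfl⟩

theorem range_dRestrict (n : ℕ) : LinearMap.range (hY.dRestrict n) =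
    ((Q.sub (n + 1) Y).map (Q.d n)).comap (Q.sub n Y).subtype := by
  ext x
  constructor
  · rintro ⟨y, rfl⟩
    exact ⟨y, y.2, rfl⟩
  · rintro ⟨y, hy, h⟩
    exact ⟨⟨y, hy⟩, Subtype.ext h⟩

theorem ker_dRestrict (n : ℕ) : LinearMap.ker (hY.dRestrict n) =
    ((Q.sub (n + 2) Y).map (Q.d (n + 1))).comap (Q.sub (n + 1) Y).subtype := by
  ext x
  refine ⟨fun hx ↦ hY.inf_ker_le n ⟨x.2, congrArg Subtype.val (LinearMap.mem_ker.1 hx)⟩, ?_⟩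
  rintro ⟨y, hy, h⟩
  refine LinearMap.mem_ker.2 (Subtype.ext ?_)
  change Q.d n x.1 = 0
  exact (congrArg (Q.d n) h).symm.trans (Q.d_d n y)

/-- Exactness of the subcomplex makes its successive syzygies kernels of surjections from free
modules, so the resolution is assembled downwards from the flat `m`th syzygy. -/
theorem hasFlatResolution (n k : ℕ) (h : n + k = m) :
    HasFlatResolution k (ModuleCat.of A (Q.Syzygy n Y)) := by
  induction k generalizing n with
  | zero =>
    obtain rfl : n = m := h
    exact hY.isLazardFlat
  | succ k ih =>
    refine ⟨ModuleCat.of A (Q.Syzygy (n + 1) Y), ModuleCat.of A (Q.sub n Y),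
      Submodule.liftQ _ (hY.dRestrict n) (hY.ker_dRestrict n).ge, Submodule.mkQ _, ?_, ?_,
      Submodule.mkQ_surjective _, (.of_basis (subBasis n Y)), ih (n + 1) (by omega)⟩
    · rw [← LinearMap.ker_eq_bot]
      exact Submodule.ker_liftQ_eq_bot _ _ _ (hY.ker_dRestrict n).le
    · rw [LinearMap.exact_iff, Submodule.range_liftQ, hY.range_dRestrict, Submodule.ker_mkQ]

theorem exists_presentation (n : ℕ) : ∃ (X : Type u) (_ : Countable X)
    (p : (X →₀ A) →ₗ[A] Q.Syzygy n Y), Function.Surjective p ∧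
      (LinearMap.ker p).IsCountablyGenerated := by
  have hc (k) : Countable (Sigma.mk k ⁻¹' Y : Set (Q.X k)) :=
    (hY.countable.preimage sigma_mk_injective).to_subtype
  have := hc n
  have := hc (n + 1)
  let e (k) := (subBasis k Y).repr
  refine ⟨_, hc n, Submodule.mkQ _ ∘ₗ (e n).symm.toLinearMap,
    (Submodule.mkQ_surjective _).comp (e n).symm.surjective, ?_⟩
  rw [LinearMap.ker_comp, Submodule.ker_mkQ, ← hY.range_dRestrict n,
    Submodule.comap_equiv_eq_map_symm, ← LinearMap.range_comp]
  have := Submodule.IsCountablyGenerated.range_finsupp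
    ((e n).toLinearMap ∘ₗ hY.dRestrict n ∘ₗ (e (n + 1)).symm.toLinearMap)
  rwa [← LinearMap.comp_assoc, LinearMap.range_comp_of_range_eq_top _
    (LinearMap.range_eq_top.2 (e (n + 1)).symm.surjective)] at this

theorem isCardinalPresentable (n : ℕ) : isCardinalPresentable (ModuleCat.{u} A)
    (ℵ₁ : Cardinal.{u}) (ModuleCat.of A (Q.Syzygy n Y)) := by
  obtain ⟨X, _, p, hp, h⟩ := hY.exists_presentation n
  exact isCardinalPresentable_of_isCountablyGenerated_ker p hp h

theorem isCountablyGenerated_top (n : ℕ) :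
    (⊤ : Submodule A (Q.Syzygy n Y)).IsCountablyGenerated := by
  obtain ⟨X, _, p, hp, h⟩ := hY.exists_presentation n
  rw [← LinearMap.range_eq_top.2 hp]
  exact .range_finsupp p

end IsGood

end FreeResolution

open FreeResolution

/-- Over a countably coherent ring, a module of flat dimension at most `m` is an `ℵ₁`-directed
colimit of countably presented modules of flat dimension at most `m`. -/
theorem HasFlatResolution.exists_directed_colimit (hA : IsCountablyCoherent A) {m : ℕ}
    {M : ModuleCat.{u} A} (hM : HasFlatResolution m M) :
    ∃ (J : Type u) (_ : PartialOrder J), (∀ S : Set J, S.Countable → BddAbove S) ∧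
      ∃ (F : J ⥤ ModuleCat.{u} A) (ι : F ⟶ (Functor.const J).obj M),
        Nonempty (IsColimit (Cocone.mk M ι)) ∧ ∀ j, HasFlatResolution m (F.obj j) ∧
          isCardinalPresentable (ModuleCat.{u} A) (ℵ₁ : Cardinal.{u}) (F.obj j) ∧
          (⊤ : Submodule A (F.obj j)).IsCountablyGenerated := by
  obtain ⟨Q⟩ := exists_freeResolution M
  let J := {Y : Set (Σ n, Q.X n) // IsGood m Y}
  have hJ (S : Set J) (hS : S.Countable) : BddAbove S := by
    -- The union of countably many good sets is countable, hence contained in a good set.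
    obtain ⟨Z, hYZ, hZ⟩ := exists_isGood hA hM (hS.biUnion fun Y _ ↦ Y.2.countable)
    exact ⟨⟨Z, hZ⟩, fun Y hY ↦ (Set.subset_biUnion_of_mem (u := Subtype.val) hY).trans hYZ⟩
  have := isCardinalFiltered_of_countable_bddAbove hJ
  have := isFiltered_of_isCardinalFiltered J (ℵ₁ : Cardinal.{u})
  let U : J →o Submodule A (Q.P 0) :=
    ⟨fun Y ↦ Q.sub 0 Y.1, fun _ _ h ↦ sub_mono 0 h⟩
  let V : J →o Submodule A (Q.P 0) :=
    ⟨fun Y ↦ (Q.sub 1 Y.1).map (Q.d 0), fun _ _ h ↦ Submodule.map_mono (sub_mono 1 h)⟩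
  have hV (Y) : V Y ≤ LinearMap.ker Q.ε := by
    rw [← Q.range_d_zero]
    exact LinearMap.map_le_range
  have hc := isElementwiseColimit_subquotientCocone U V Q.ε hV (Q.ε_surjective)
    (fun x ↦ by
      obtain ⟨T, hxT, -⟩ := exists_mem_sub x
      obtain ⟨Z, hTZ, hZ⟩ := exists_isGood hA hM T.countable_toSet
      exact ⟨⟨Z, hZ⟩, sub_mono 0 hTZ hxT⟩)
    (fun Y x _ hx ↦ by
      rw [← LinearMap.mem_ker, ← Q.range_d_zero] at hx
      obtain ⟨w, rfl⟩ := hx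
      obtain ⟨T, hwT, -⟩ := exists_mem_sub w
      obtain ⟨Z, hTZ, hZ⟩ := exists_isGood hA hM (Y.2.countable.union T.countable_toSet)
      exact ⟨⟨Z, hZ⟩, Set.subset_union_left.trans hTZ, w,
        sub_mono 1 (Set.subset_union_right.trans hTZ) hwT, rfl⟩)
  exact ⟨J, inferInstance, hJ, subquotientFunctor U V, (subquotientCocone U V Q.ε hV).ι,
    hc.nonempty_isColimit, fun Y ↦ ⟨Y.2.hasFlatResolution 0 m (zero_add m),
      Y.2.isCardinalPresentable 0, Y.2.isCountablyGenerated_top 0⟩⟩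

end FreeResolution

/-! ### Accessibility of the category of modules of bounded flat dimension -/

section Accessible

variable {R : Type u} [Ring R]

instance flatDimLE_isClosedUnderColimitsOfShape (m : ℕ) (J : Type u) [SmallCategory J]
    [IsCardinalFiltered J (ℵ₁ : Cardinal.{u})] :
    (flatDimLE R m).IsClosedUnderColimitsOfShape J where
  colimitsOfShape_le := by
    rintro M ⟨h⟩
    have := isFiltered_of_isCardinalFiltered J (ℵ₁ : Cardinal.{u})
    exact ((IsElementwiseColimit.of_isColimit h.isColimit).hasFlatResolution
      fun j ↦ (h.prop_diag_obj j).hasFlatResolution).flatDimLE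

instance flatDimLE_hasCardinalFilteredColimits (m : ℕ) :
    HasCardinalFilteredColimits (flatDimLE R m).FullSubcategory (ℵ₁ : Cardinal.{u}) where
  hasColimitsOfShape _ _ _ := inferInstance

instance flatDimLE_ι_isCardinalAccessible (m : ℕ) :
    (flatDimLE R m).ι.IsCardinalAccessible (ℵ₁ : Cardinal.{u}) where
  preservesColimitOfShape _ _ _ := inferInstance

/-- The Hom functor in the subcategory is the Hom functor of modules composed with the inclusion,
which preserves `ℵ₁`-filtered colimits. -/
theorem isCardinalPresentable_fullSubcategory {m : ℕ} (X : (flatDimLE R m).FullSubcategory)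
    (hX : countablyPresentable R X.obj) : IsCardinalPresentable X (ℵ₁ : Cardinal.{u}) := by
  have : IsCardinalPresentable X.obj (ℵ₁ : Cardinal.{u}) := hX
  let e : coyoneda.obj (Opposite.op X) ≅
      (flatDimLE R m).ι ⋙ coyoneda.obj (Opposite.op X.obj) :=
    NatIso.ofComponents (fun Y ↦ ((flatDimLE R m).fullyFaithfulι.homEquiv (X := X) (Y := Y)).toIso)
      fun _ ↦ rfl
  exact Functor.isCardinalAccessible_of_natIso e.symm _

theorem exists_surjective_finsupp_nat {A : Type u} [Ring A] {M : Type u} [AddCommGroup M]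
    [Module A M] (h : (⊤ : Submodule A M).IsCountablyGenerated) :
    ∃ p : (ℕ →₀ A) →ₗ[A] M, Function.Surjective p := by
  obtain ⟨s, hs, hsM⟩ := h
  -- Inserting `0` makes the generating set nonempty, so that it can be enumerated by `ℕ`.
  obtain ⟨v, hv⟩ := (hs.insert 0).exists_eq_range (Set.insert_nonempty _ _)
  refine ⟨Finsupp.linearCombination A v, LinearMap.range_eq_top.1 ?_⟩
  rw [Finsupp.range_linearCombination, ← hv, ← top_le_iff, ← hsM]
  exact Submodule.span_mono (Set.subset_insert _ _)

variable (R) in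
/-- The countably generated, countably presentable right modules of flat dimension at most `m`. -/
def countableFlatDimLE (m : ℕ) : ObjectProperty (flatDimLE R m).FullSubcategory := fun X ↦
  countablyPresentable R X.obj ∧ (⊤ : Submodule Rᵐᵒᵖ X.obj).IsCountablyGenerated

/-- Up to isomorphism a quotient of `P` is given by a submodule of `P`, and these form a set in the
same universe. With `P` free on `ℕ`, this is why countable generation is recorded in
`countableFlatDimLE`. -/
theorem essentiallySmall_quotients {A : Type u} [Ring A] (W : ObjectProperty (ModuleCat.{u} A))
    [W.IsClosedUnderIsomorphisms] (P : ModuleCat.{u} A) :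
    ObjectProperty.EssentiallySmall.{u} (C := W.FullSubcategory)
      fun X ↦ ∃ p : P →ₗ[A] X.obj, Function.Surjective p where
  exists_small_le' := by
    let f (N : {N : Submodule A P // W (ModuleCat.of A (P ⧸ N))}) : W.FullSubcategory := ⟨_, N.2⟩
    refine ⟨ObjectProperty.ofObj f, inferInstance, ?_⟩
    rintro X ⟨p, hp⟩
    let e : ModuleCat.of A (P ⧸ LinearMap.ker p) ≅ X.obj :=
      (p.quotKerEquivOfSurjective hp).toModuleIso
    exact ⟨f ⟨_, W.prop_of_iso e.symm X.property⟩, ⟨_⟩, ⟨W.fullyFaithfulι.preimageIso e.symm⟩⟩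

instance flatDimLE_isClosedUnderIsomorphisms (m : ℕ) :
    (flatDimLE R m).IsClosedUnderIsomorphisms where
  of_iso e h := (h.hasFlatResolution.of_linearEquiv e.toLinearEquiv).flatDimLE

instance countableFlatDimLE_essentiallySmall (m : ℕ) :
    ObjectProperty.EssentiallySmall.{u} (countableFlatDimLE R m) := by
  obtain ⟨Q, hQ, h⟩ := (essentiallySmall_quotients (flatDimLE R m)
    (ModuleCat.of Rᵐᵒᵖ (ℕ →₀ Rᵐᵒᵖ))).exists_small_le'
  exact ⟨Q, hQ, fun X hX ↦ h X (exists_surjective_finsupp_nat hX.2)⟩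

theorem countableFlatDimLE_isCardinalFilteredGenerator (hR : IsRightCountablyCoherent R) (m : ℕ) :
    (countableFlatDimLE R m).IsCardinalFilteredGenerator (ℵ₁ : Cardinal.{u}) where
  le_isCardinalPresentable X hX := isCardinalPresentable_fullSubcategory X hX.1
  exists_colimitsOfShape X := by
    obtain ⟨J, _, hJ, F, ι, ⟨hc⟩, hF⟩ :=
      X.property.hasFlatResolution.exists_directed_colimit hR.isCountablyCoherent
    let G : J ⥤ (flatDimLE R m).FullSubcategory :=
      (flatDimLE R m).lift F fun j ↦ (hF j).1.flatDimLE
    let τ : G ⟶ (Functor.const J).obj X :=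
      { app := fun j ↦ ObjectProperty.homMk (ι.app j)
        naturality := fun j k f ↦ by
          apply (flatDimLE R m).ι.map_injective
          exact ι.naturality f }
    have hτ : IsColimit (Cocone.mk X τ) := isColimitOfReflects (flatDimLE R m).ι hc
    exact ⟨J, inferInstance, isCardinalFiltered_of_countable_bddAbove hJ,
      ⟨{ diag := G, ι := τ, isColimit := hτ, prop_diag_obj := fun j ↦ (hF j).2 }⟩⟩

end Accessible

theorem mainTheorem1 (R : Type u) [Ring R] (hR : IsRightCountablyCoherent R) (m : ℕ) :
    IsCardinalAccessibleCategory (flatDimLE R m).FullSubcategory (ℵ₁ : Cardinal.{u}) ∧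
    (∀ X : (flatDimLE R m).FullSubcategory,
      IsCardinalPresentable X (ℵ₁ : Cardinal.{u}) ↔ countablyPresentable R X.obj) ∧
    (∀ M : ModuleCat.{u} Rᵐᵒᵖ, flatDimLE R m M →
      ∃ (J : Type u) (_ : PartialOrder J), (∀ S : Set J, S.Countable → BddAbove S) ∧
        (flatDimLE R m ⊓ countablyPresentable R).colimitsOfShape J M) := by
  have hgen := countableFlatDimLE_isCardinalFilteredGenerator hR m
  have := hgen.hasCardinalFilteredGenerator
  refine ⟨{ }, fun X ↦ ⟨fun hX ↦ ?_, isCardinalPresentable_fullSubcategory X⟩, fun M hM ↦ ?_⟩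
  · have : isCardinalPresentable _ (ℵ₁ : Cardinal.{u}) X := hX
    -- A presentable object is a retract of a generating one; the inclusion sends this to a
    -- retraction of modules, and countable presentability passes to retracts.
    rw [hgen.isPresentable_eq_retractClosure] at this
    obtain ⟨Y, hY, ⟨r⟩⟩ := this
    exact ObjectProperty.prop_of_retract _ (r.map (flatDimLE R m).ι) hY.1
  · obtain ⟨J, _, hJ, F, ι, ⟨hc⟩, hF⟩ :=
      hM.hasFlatResolution.exists_directed_colimit hR.isCountablyCoherent
    exact ⟨J, inferInstance, hJ, ⟨{
      diag := F
      ι := ι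
      isColimit := hc
      prop_diag_obj := fun j ↦ ⟨(hF j).1.flatDimLE, (hF j).2.1⟩ }⟩⟩
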